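/- Let $n\ge 1$, $d=n+1$, $m>0$, and write $x\cdot y=x_0y_0-\sum_{i=1}^n x_iy_i$ for the Lorentzian scalar product on $\mathbb R^d$. Let $\omega_{\mathbf p}=(\mathbf p^2+m^2)^{1/2}$, $d\mu(\mathbf p)=d^n\mathbf p/(2\omega_{\mathbf p})$, $\mathscr H_1=L^2(\mathbb R^n,d\mu)$, and let $\mathscr H=\bigoplus_{k\ge0}\mathscr H_k$ be the bosonic Fock space over $\mathscr H_1$, where $\mathscr H_k$ is the $k$-fold symmetric Hilbert tensor power of $\mathscr H_1$. On vectors of finite particle number let $N$ be the particle number operator, $a^*(h)$ and $a(h)=a^*(h)^*$ ($h\in\mathscr H_1$) the creation and annihilation operators ($a^*(h)\Psi=\sqrt{k+1}\,P_{k+1}(h\otimes\Psi)$ for $\Psi\in\mathscr H_k$, with $P_{k+1}$ the orthogonal projection onto $\mathscr H_{k+1}$), and $\Gamma(W)=\bigoplus_k W^{\otimes k}$ the second quantization of a unitary $W$ on $\mathscr H_1$. For $f\in\mathscr S(\mathbb R^d)$ put $f^\pm(\mathbf p)=\int dx\,f(x)e^{\pm ip\cdot x}$ with $p=(\omega_{\mathbf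 p},\mathbf p)$, considered as elements of $\mathscr H_1$, and let $\phi(f)=a(\overline{f^-})+a^*(f^+)$ be the free scalar field of mass $m$. Let $P=(P_\mu)$ be the second quantized momentum operator, so that $e^{iy\cdot P}=\Gamma(e^{iy\cdot p})$, where $e^{iy\cdot p}$ acts on $\mathscr H_1$ by multiplication. Let $V$ be a unitary operator on $\mathscr H_1$, $X_\mu=\Gamma(V^{-1})P_\mu\Gamma(V)$, and $V(y)=e^{iy\cdot X}=\Gamma(V^{-1})e^{iy\cdot P}\Gamma(V)$ for $y\in\mathbb R^d$. Let $\Delta(P)$ be the set of all $\psi\in\mathscr H_1$ such that $(\mathbf p^2)^r\psi(\mathbf p)$ is (essentially) bounded for every $r=0,1,2,\dots$; let $\Delta_k(P)\subset\mathscr H_k$ be the linear span of the symmetrized products of $k$ elements of $\Delta(P)$, $\Delta_k(X)=\Gamma(V^{-1})\Delta_k(P)$, and $\Delta(X)$ the algebraic direct sum of the spaces $\Delta_k(X)$, $k\ge0$. Let $\theta$ be a real $d\times d$ matrix that is skew-symmetric with respect to the Lorentzian scalar product. Then the deformed operators $a_{\theta,X}(\overline{f^-})$, $a^*_{\theta,X}(f^+)$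 and $\phi_{\theta,X}(f)$ are well defined linear operators from $\Delta(X)$ to $\mathscr H$: for $A=a(\overline{f^-})$, $A=a^*(f^+)$ and $A=\phi(f)$, for every $\Phi\in\Delta(X)$ (in particular for every $\Phi\in\Delta_k(X)$) and every $\chi\in\mathscr S(\mathbb R^d\times\mathbb R^d)$ with $\chi(0,0)=1$, the integrals below exist for all $\varepsilon\ne0$, and the limit $$A_{\theta,X}\Phi=(2\pi)^{-d}\lim_{\varepsilon\to0}\iint dx\,dy\;e^{-ix\cdot y}\,\chi(\varepsilon x,\varepsilon y)\,V(\theta x)\,A\,V(\theta x)^{-1}\,V(y)\Phi$$ exists in the norm of $\mathscr H$, does not depend on $\chi$, and is linear in $\Phi$. Moreover $\phi_{\theta,X}(f)\Phi=a_{\theta,X}(\overline{f^-})\Phi+a^*_{\theta,X}(f^+)\Phi$, and the bounds of the free field hold: with $\Psi=\Gamma(V)\Phi$, $$\|a_{\theta,X}(\overline{f^-})\Phi\|\le\|f^-\|\,\|(N+1)^{1/2}\Phi\|,\qquad \|a^*_{\theta,X}(f^+)\Phi\|\le\|f^+\|\,\|(N+1)^{1/2}\Phi\|,$$ $$\|\phi_{\theta,X}(f)\Phi\|\le\big(\|f^+\|+\|f^-\|\big)\,\|(N+1)^{1/2}\Psi\|,\qquad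 \|(N+1)^{1/2}\Psi\|=\|(N+1)^{1/2}\Phi\|.$$ -/

import Mathlib

open MeasureTheory Filter Topology
open scoped ENNReal SchwartzMap InnerProductSpace FourierTransform

noncomputable section

namespace DeformedField

/-! ### Bosonic Fock space over `L²(α, μ)` -/

section Fock

variable {α : Type*} [MeasurableSpace α] (μ : Measure α) [SigmaFinite μ]

/-- The `k`-fold product measure. -/
abbrev piMeasure (k : ℕ) : Measure (Fin k → α) := Measure.pi fun _ : Fin k => μ

/-- The one-particle space `L²(α, μ)`. -/
abbrev OneParticle : Type _ := Lp ℂ 2 μ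

/-- The space of (not necessarily symmetric) `k`-particle wave functions `L²(αᵏ, μᵏ)`. -/
abbrev WaveFunction (k : ℕ) : Type _ := Lp ℂ 2 (piMeasure μ k)

variable {μ}

lemma aestronglyMeasurable_eval {k : ℕ} {f : α → ℂ} (hf : AEStronglyMeasurable f μ) (i : Fin k) :
    AEStronglyMeasurable (fun p : Fin k → α => f (p i)) (piMeasure μ k) :=
  hf.comp_quasiMeasurePreserving (Measure.quasiMeasurePreserving_eval (fun _ : Fin k => μ) i)

lemma memLp_prod {k : ℕ} (f : Fin k → OneParticle μ) :
    MemLp (fun p : Fin k → α => ∏ i, f i (p i)) 2 (piMeasure μ k) := by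
  have hm : AEStronglyMeasurable (fun p : Fin k → α => ∏ i, f i (p i)) (piMeasure μ k) := by
    have := Finset.aestronglyMeasurable_prod (μ := piMeasure μ k) (M := ℂ) Finset.univ
      (f := fun i p => f i (p i))
      fun i _ => aestronglyMeasurable_eval (Lp.aestronglyMeasurable (f i)) i
    refine this.congr (Eventually.of_forall fun p => ?_)
    simp
  rw [memLp_two_iff_integrable_sq_norm hm]
  have := Integrable.fintype_prod (μ := fun _ : Fin k => μ) (𝕜 := ℝ)
    (f := fun i x => ‖f i x‖ ^ 2)
    fun i => (memLp_two_iff_integrable_sq_norm (Lp.aestronglyMeasurable (f i))).1 (Lp.memLp (f i))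
  refine this.congr (Eventually.of_forall fun p => ?_)
  simp [Finset.prod_pow]

/-- The product wave function `(f₁ ⊗ ⋯ ⊗ f_k)(p₁, …, p_k) = f₁(p₁) ⋯ f_k(p_k)`. -/
def tensorProd {k : ℕ} (f : Fin k → OneParticle μ) : WaveFunction μ k :=
  (memLp_prod f).toLp _

lemma inner_tensorProd {k : ℕ} (f g : Fin k → OneParticle μ) :
    ⟪tensorProd f, tensorProd g⟫_ℂ = ∏ i, ⟪f i, g i⟫_ℂ := by
  have h : (fun p : Fin k → α => ⟪tensorProd f p, tensorProd g p⟫_ℂ)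
      =ᵐ[piMeasure μ k] fun p => ∏ i, ⟪f i (p i), g i (p i)⟫_ℂ := by
    filter_upwards [(memLp_prod f).coeFn_toLp, (memLp_prod g).coeFn_toLp] with p hf hg
    simp only [tensorProd, hf, hg, RCLike.inner_apply, map_prod, Finset.prod_mul_distrib]
  rw [L2.inner_def, integral_congr_ae h]
  rw [integral_fintype_prod_eq_prod (μ := fun _ : Fin k => μ)
    (fun i x => ⟪f i x, g i x⟫_ℂ)]
  simp [L2.inner_def]

/-- The symmetrised product `(1 / k!) ∑_σ f_{σ(1)} ⊗ ⋯ ⊗ f_{σ(k)}`. -/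
def symProd {k : ℕ} (f : Fin k → OneParticle μ) : WaveFunction μ k :=
  ((k.factorial : ℂ)⁻¹) • ∑ σ : Equiv.Perm (Fin k), tensorProd fun i => f (σ i)

variable (μ)

/-- The bosonic `k`-particle space: the closed linear span, inside `L²(αᵏ, μᵏ)`, of the symmetrised
products, i.e. the `k`-fold symmetric Hilbert tensor power of `L²(α, μ)`. -/
def symSubspace (k : ℕ) : Submodule ℂ (WaveFunction μ k) :=
  (Submodule.span ℂ (Set.range (symProd : (Fin k → OneParticle μ) → WaveFunction μ k))).topologicalClosure

/-- The bosonic `k`-particle Hilbert space. -/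
abbrev Sector (k : ℕ) : Type _ := symSubspace μ k

instance (k : ℕ) : CompleteSpace (Sector μ k) :=
  (Submodule.isClosed_topologicalClosure _).completeSpace_coe

/-- The bosonic Fock space, the Hilbert sum of the sectors. -/
abbrev Fock : Type _ := lp (fun k : ℕ => Sector μ k) 2

variable {μ}

/-- The symmetrised product, as an element of the sector. -/
def symVec {k : ℕ} (f : Fin k → OneParticle μ) : Sector μ k :=
  ⟨symProd f, Submodule.le_topologicalClosure _ (Submodule.subset_span ⟨f, rfl⟩)⟩

/-! ### Second quantization of isometries -/

variable (μ) in
/-- The formal linear combinations of symmetrised products, mapped to the sector. -/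
def combi (k : ℕ) : ((Fin k → OneParticle μ) →₀ ℂ) →ₗ[ℂ] Sector μ k :=
  Finsupp.linearCombination ℂ symVec

lemma denseRange_combi (k : ℕ) : DenseRange (combi μ k) := by
  intro x
  rw [Metric.mem_closure_iff]
  intro ε hε
  have hx : (x : WaveFunction μ k) ∈ closure
      ((Submodule.span ℂ (Set.range (symProd : (Fin k → OneParticle μ) → WaveFunction μ k)) :
        Submodule ℂ (WaveFunction μ k)) : Set (WaveFunction μ k)) := x.2
  obtain ⟨y, hy, hxy⟩ := Metric.mem_closure_iff.1 hx ε hε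
  obtain ⟨c, rfl⟩ := (Finsupp.mem_span_range_iff_exists_finsupp).1 hy
  refine ⟨_, ⟨c, rfl⟩, ?_⟩
  have : ((combi μ k c : Sector μ k) : WaveFunction μ k) = c.sum fun f a => a • symProd f := by
    simp [combi, Finsupp.linearCombination_apply, Finsupp.sum, symVec]
  rw [Subtype.dist_eq, this]
  exact hxy

/-- The prescription `S(f₁ ⊗ ⋯ ⊗ f_k) ↦ S(W f₁ ⊗ ⋯ ⊗ W f_k)` on formal linear combinations. -/
def combiMap (W : OneParticle μ →ₗᵢ[ℂ] OneParticle μ) (k : ℕ) :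
    ((Fin k → OneParticle μ) →₀ ℂ) →ₗ[ℂ] Sector μ k :=
  Finsupp.linearCombination ℂ fun f => symVec fun i => W (f i)

lemma inner_symVec_map (W : OneParticle μ →ₗᵢ[ℂ] OneParticle μ) {k : ℕ}
    (f g : Fin k → OneParticle μ) :
    ⟪symVec fun i => W (f i), symVec fun i => W (g i)⟫_ℂ = ⟪symVec f, symVec g⟫_ℂ := by
  simp only [symVec, Submodule.coe_inner, symProd, inner_smul_left, inner_smul_right, sum_inner,
    inner_sum, inner_tensorProd, LinearIsometry.inner_map_map]

lemma norm_combiMap (W : OneParticle μ →ₗᵢ[ℂ] OneParticle μ) (k : ℕ)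
    (c : (Fin k → OneParticle μ) →₀ ℂ) : ‖combiMap W k c‖ = ‖combi μ k c‖ := by
  rw [@norm_eq_sqrt_re_inner ℂ, @norm_eq_sqrt_re_inner ℂ]
  congr 2
  simp only [combiMap, combi, Finsupp.linearCombination_apply, Finsupp.sum, sum_inner, inner_sum,
    inner_smul_left, inner_smul_right, inner_symVec_map]

/-- `W ⊗ ⋯ ⊗ W` on the `k`-particle sector: the unique bounded operator with
`S(f₁ ⊗ ⋯ ⊗ f_k) ↦ S(W f₁ ⊗ ⋯ ⊗ W f_k)`. -/
def sectorGamma (W : OneParticle μ →ₗᵢ[ℂ] OneParticle μ) (k : ℕ) : Sector μ k →L[ℂ] Sector μ k :=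
  (combiMap W k).extendOfNorm (combi μ k)

lemma sectorGamma_combi (W : OneParticle μ →ₗᵢ[ℂ] OneParticle μ) (k : ℕ)
    (c : (Fin k → OneParticle μ) →₀ ℂ) : sectorGamma W k (combi μ k c) = combiMap W k c :=
  LinearMap.extendOfNorm_eq (denseRange_combi k) ⟨1, fun x => by rw [norm_combiMap, one_mul]⟩ c

lemma sectorGamma_symVec (W : OneParticle μ →ₗᵢ[ℂ] OneParticle μ) {k : ℕ}
    (f : Fin k → OneParticle μ) : sectorGamma W k (symVec f) = symVec fun i => W (f i) := by
  have := sectorGamma_combi W k (Finsupp.single f 1)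
  simpa [combi, combiMap] using this

lemma norm_sectorGamma (W : OneParticle μ →ₗᵢ[ℂ] OneParticle μ) (k : ℕ) (Ψ : Sector μ k) :
    ‖sectorGamma W k Ψ‖ = ‖Ψ‖ := by
  refine (denseRange_combi k).induction_on (p := fun Ψ => ‖sectorGamma W k Ψ‖ = ‖Ψ‖) Ψ
    (isClosed_eq (by fun_prop) (by fun_prop)) fun c => ?_
  rw [sectorGamma_combi, norm_combiMap]

/-! ### Vectors of finite particle number -/

variable (μ) in
/-- The dense subspace of the Fock space of vectors of finite particle number. -/
def finiteParticle : Submodule ℂ (Fock μ) where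
  carrier := {Ψ | ∃ K : ℕ, ∀ k, K ≤ k → Ψ k = 0}
  zero_mem' := ⟨0, fun k _ => rfl⟩
  add_mem' := by
    rintro Ψ Φ ⟨K, hK⟩ ⟨L, hL⟩
    refine ⟨max K L, fun k hk => ?_⟩
    rw [lp.coeFn_add, Pi.add_apply, hK k (le_trans (le_max_left _ _) hk),
      hL k (le_trans (le_max_right _ _) hk), add_zero]
  smul_mem' := by
    rintro c Ψ ⟨K, hK⟩
    exact ⟨K, fun k hk => by rw [lp.coeFn_smul, Pi.smul_apply, hK k hk, smul_zero]⟩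

lemma memℓp_of_eventually_zero {Ψ : (k : ℕ) → Sector μ k} {K : ℕ}
    (h : ∀ k, K ≤ k → Ψ k = 0) : Memℓp Ψ 2 := by
  refine Memℓp.of_exponent_ge (memℓp_zero ?_) zero_le
  refine (Set.finite_lt_nat K).subset fun k hk => ?_
  by_contra hlt
  exact hk (h k (not_lt.1 hlt))

/-- The finite particle vector with the given components. -/
def finVec (Ψ : (k : ℕ) → Sector μ k) (h : ∃ K : ℕ, ∀ k, K ≤ k → Ψ k = 0) : finiteParticle μ :=
  ⟨⟨Ψ, memℓp_of_eventually_zero h.choose_spec⟩, h⟩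

lemma finiteParticle_ext {Ψ Φ : finiteParticle μ}
    (h : ∀ k, (Ψ : Fock μ) k = (Φ : Fock μ) k) : Ψ = Φ :=
  Subtype.ext (lp.ext (funext h))

/-- The operator on finite particle vectors acting as `A k` on the `k`-particle sector. -/
def diagOp (A : (k : ℕ) → Sector μ k →ₗ[ℂ] Sector μ k) :
    finiteParticle μ →ₗ[ℂ] finiteParticle μ where
  toFun Ψ := finVec (fun k => A k ((Ψ : Fock μ) k)) (by
    obtain ⟨K, hK⟩ := Ψ.2
    exact ⟨K, fun k hk => by rw [hK k hk, map_zero]⟩)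
  map_add' Ψ Φ := finiteParticle_ext fun k => by
    change A k ((Ψ : Fock μ) k + (Φ : Fock μ) k) = _
    rw [map_add]; rfl
  map_smul' c Ψ := finiteParticle_ext fun k => by
    change A k (c • (Ψ : Fock μ) k) = _
    rw [map_smul]; rfl

/-- The operator on finite particle vectors mapping the `k`-particle sector to the
`(k+1)`-particle sector by `A k`. -/
def raiseOp (A : (k : ℕ) → Sector μ k →ₗ[ℂ] Sector μ (k + 1)) :
    finiteParticle μ →ₗ[ℂ] finiteParticle μ where
  toFun Ψ := finVec
    (fun k => match k with
      | 0 => 0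
      | k + 1 => A k ((Ψ : Fock μ) k)) (by
    obtain ⟨K, hK⟩ := Ψ.2
    refine ⟨K + 1, fun k hk => ?_⟩
    cases k with
    | zero => rfl
    | succ k => simp only [hK k (by omega), map_zero])
  map_add' Ψ Φ := finiteParticle_ext fun k => by
    cases k with
    | zero => exact (add_zero (0 : Sector μ 0)).symm
    | succ k =>
      change A k ((Ψ : Fock μ) k + (Φ : Fock μ) k) = _
      rw [map_add]; rfl
  map_smul' c Ψ := finiteParticle_ext fun k => by
    cases k with
    | zero => exact (smul_zero (A := Sector μ 0) c).symm
    | succ k =>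
      change A k (c • (Ψ : Fock μ) k) = _
      rw [map_smul]; rfl

/-- The operator on finite particle vectors mapping the `(k+1)`-particle sector to the
`k`-particle sector by `A k`, and the vacuum to zero. -/
def lowerOp (A : (k : ℕ) → Sector μ (k + 1) →ₗ[ℂ] Sector μ k) :
    finiteParticle μ →ₗ[ℂ] finiteParticle μ where
  toFun Ψ := finVec (fun k => A k ((Ψ : Fock μ) (k + 1))) (by
    obtain ⟨K, hK⟩ := Ψ.2
    exact ⟨K, fun k hk => by rw [hK (k + 1) (by omega), map_zero]⟩)
  map_add' Ψ Φ := finiteParticle_ext fun k => by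
    change A k ((Ψ : Fock μ) (k + 1) + (Φ : Fock μ) (k + 1)) = _
    rw [map_add]; rfl
  map_smul' c Ψ := finiteParticle_ext fun k => by
    change A k (c • (Ψ : Fock μ) (k + 1)) = _
    rw [map_smul]; rfl

variable (μ) in
/-- The inclusion of the `k`-particle sector. -/
def inclSector (k : ℕ) : Sector μ k →ₗ[ℂ] finiteParticle μ where
  toFun Ψ := ⟨lp.single 2 k Ψ, k + 1, fun j hj =>
    lp.single_apply_ne (E := fun k : ℕ => Sector μ k) 2 k Ψ (by omega)⟩
  map_add' Ψ Φ := Subtype.ext (lp.single_add 2 k Ψ Φ)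
  map_smul' c Ψ := Subtype.ext (lp.single_smul 2 k c Ψ)

/-- The second quantization `Γ(W) = ⨁ₖ W^{⊗ k}`, restricted to finite particle vectors. -/
def secondQuant (W : OneParticle μ ≃ₗᵢ[ℂ] OneParticle μ) :
    finiteParticle μ →ₗ[ℂ] finiteParticle μ :=
  diagOp fun k => (sectorGamma W.toLinearIsometry k : Sector μ k →ₗ[ℂ] Sector μ k)

variable (μ) in
/-- `(N + 1)^{1/2}` on finite particle vectors, `N` being the particle number operator. -/
def sqrtNumberAddOne : finiteParticle μ →ₗ[ℂ] finiteParticle μ :=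
  diagOp fun k => ((Real.sqrt ((k : ℝ) + 1) : ℝ) : ℂ) • LinearMap.id

/-! ### Creation and annihilation operators -/

lemma memLp_cons (h : OneParticle μ) {k : ℕ} (Ψ : WaveFunction μ k) :
    MemLp (fun p : Fin (k + 1) → α => h (p 0) * Ψ (Fin.tail p)) 2 (piMeasure μ (k + 1)) := by
  have hmp := measurePreserving_piFinSuccAbove (fun _ : Fin (k + 1) => μ) 0
  have hprod : MemLp (fun z : α × (Fin k → α) => h z.1 * Ψ z.2) 2 (μ.prod (piMeasure μ k)) := by
    have hm : AEStronglyMeasurable (fun z : α × (Fin k → α) => h z.1 * Ψ z.2)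
        (μ.prod (piMeasure μ k)) :=
      (Lp.aestronglyMeasurable h).comp_fst.mul (Lp.aestronglyMeasurable Ψ).comp_snd
    rw [memLp_two_iff_integrable_sq_norm hm]
    refine (((memLp_two_iff_integrable_sq_norm (Lp.aestronglyMeasurable h)).1
      (Lp.memLp h)).mul_prod ((memLp_two_iff_integrable_sq_norm
        (Lp.aestronglyMeasurable Ψ)).1 (Lp.memLp Ψ))).congr (Eventually.of_forall fun z => ?_)
    simp [mul_pow]
  exact hprod.comp_measurePreserving hmp

/-- The wave function `(h ⊗ Ψ)(p₀, p₁, …, p_k) = h(p₀) Ψ(p₁, …, p_k)`. -/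
def tensorCons (h : OneParticle μ) {k : ℕ} (Ψ : WaveFunction μ k) : WaveFunction μ (k + 1) :=
  (memLp_cons h Ψ).toLp _

lemma norm_tensorCons (h : OneParticle μ) {k : ℕ} (Ψ : WaveFunction μ k) :
    ‖tensorCons h Ψ‖ = ‖h‖ * ‖Ψ‖ := by
  have key : ∀ {β : Type _} [MeasurableSpace β] {ν : Measure β} (f : Lp ℂ 2 ν),
      ‖f‖ ^ 2 = ∫ x, ‖f x‖ ^ 2 ∂ν := by
    intro β _ ν f
    have h1 : ⟪f, f⟫_ℂ = ((∫ x, ‖f x‖ ^ 2 ∂ν : ℝ) : ℂ) := by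
      rw [L2.inner_def, ← integral_complex_ofReal]
      congr 1
      ext x
      rw [inner_self_eq_norm_sq_to_K]
      simp
    have h2 := inner_self_eq_norm_sq_to_K (𝕜 := ℂ) f
    rw [h1] at h2
    exact (Complex.ofReal_injective (by simpa using h2)).symm
  have hmp := measurePreserving_piFinSuccAbove (fun _ : Fin (k + 1) => μ) 0
  have hsq : ‖tensorCons h Ψ‖ ^ 2 = (‖h‖ * ‖Ψ‖) ^ 2 := by
    rw [key, mul_pow, key h, key Ψ]
    have hae : (fun p => ‖tensorCons h Ψ p‖ ^ 2) =ᵐ[piMeasure μ (k + 1)]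
        fun p => ‖h (p 0)‖ ^ 2 * ‖Ψ (Fin.tail p)‖ ^ 2 := by
      filter_upwards [(memLp_cons h Ψ).coeFn_toLp] with p hp
      rw [tensorCons, hp, norm_mul, mul_pow]
    rw [integral_congr_ae hae]
    have := hmp.integral_comp' (fun z : α × (Fin k → α) => ‖h z.1‖ ^ 2 * ‖Ψ z.2‖ ^ 2)
    refine Eq.trans this ?_
    exact integral_prod_mul (fun x => ‖h x‖ ^ 2) (fun y => ‖Ψ y‖ ^ 2)
  exact (pow_left_inj₀ (norm_nonneg _) (by positivity) two_ne_zero).1 hsq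

lemma ae_tail {k : ℕ} {P : (Fin k → α) → Prop} (h : ∀ᵐ p ∂piMeasure μ k, P p) :
    ∀ᵐ p ∂piMeasure μ (k + 1), P (Fin.tail p) := by
  have hmp := measurePreserving_piFinSuccAbove (fun _ : Fin (k + 1) => μ) 0
  have h1 : ∀ᵐ z ∂μ.prod (piMeasure μ k), P z.2 := Measure.quasiMeasurePreserving_snd.ae h
  exact hmp.quasiMeasurePreserving.ae h1

/-- `Ψ ↦ h ⊗ Ψ` as a bounded operator. -/
def tensorConsL (h : OneParticle μ) (k : ℕ) : WaveFunction μ k →L[ℂ] WaveFunction μ (k + 1) :=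
  LinearMap.mkContinuous
    { toFun := tensorCons h
      map_add' := fun Ψ Φ => by
        apply Lp.ext
        filter_upwards [(memLp_cons h (Ψ + Φ)).coeFn_toLp, (memLp_cons h Ψ).coeFn_toLp,
          (memLp_cons h Φ).coeFn_toLp, Lp.coeFn_add (tensorCons h Ψ) (tensorCons h Φ),
          ae_tail (Lp.coeFn_add Ψ Φ)] with p h1 h2 h3 h4 h5
        rw [h4, Pi.add_apply, tensorCons, tensorCons, tensorCons, h1, h2, h3, h5, Pi.add_apply,
          mul_add]
      map_smul' := fun c Ψ => by
        apply Lp.ext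
        filter_upwards [(memLp_cons h (c • Ψ)).coeFn_toLp, (memLp_cons h Ψ).coeFn_toLp,
          Lp.coeFn_smul c (tensorCons h Ψ), ae_tail (Lp.coeFn_smul c Ψ)] with p h1 h2 h4 h5
        rw [RingHom.id_apply, h4, Pi.smul_apply, tensorCons, tensorCons, h1, h2, h5, Pi.smul_apply,
          smul_eq_mul, smul_eq_mul]
        ring }
    ‖h‖ fun Ψ => (norm_tensorCons h Ψ).le

/-- Creation on the `k`-particle sector: `Ψ ↦ √(k+1) P_{k+1} (h ⊗ Ψ)`, where `P_{k+1}` is the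
orthogonal projection onto the bosonic `(k+1)`-particle space. -/
def sectorCreate (h : OneParticle μ) (k : ℕ) : Sector μ k →L[ℂ] Sector μ (k + 1) :=
  ((Real.sqrt ((k : ℝ) + 1) : ℝ) : ℂ) •
    ((symSubspace μ (k + 1)).orthogonalProjectionOnto.comp
      ((tensorConsL h k).comp (symSubspace μ k).subtypeL))

/-- The creation operator `a*(h)` (linear in `h`). -/
def create (h : OneParticle μ) : finiteParticle μ →ₗ[ℂ] finiteParticle μ :=
  raiseOp fun k => (sectorCreate h k : Sector μ k →ₗ[ℂ] Sector μ (k + 1))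

/-- The annihilation operator `a(h)`, adjoint of `a*(h)` (antilinear in `h`). -/
def annihilate (h : OneParticle μ) : finiteParticle μ →ₗ[ℂ] finiteParticle μ :=
  lowerOp fun k => ((sectorCreate h k).adjoint : Sector μ (k + 1) →ₗ[ℂ] Sector μ k)

end Fock

/-! ### The one-particle space of mass `m` in `d = n + 1` space-time dimensions -/

/-- Momentum space `ℝⁿ`. -/
abbrev Mom (n : ℕ) : Type := EuclideanSpace ℝ (Fin n)

/-- Space-time `ℝᵈ`, `d = n + 1`; the coordinate `0` is time. -/
abbrev SpaceTime (n : ℕ) : Type := EuclideanSpace ℝ (Fin (n + 1))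

/-- The Lorentzian scalar product `x₀ y₀ - x₁ y₁ - ⋯ - x_n y_n`. -/
def lorentz {n : ℕ} (x y : SpaceTime n) : ℝ := x 0 * y 0 - ∑ i : Fin n, x i.succ * y i.succ

/-- The energy `ω_p = √(p² + m²)`. -/
def energy {n : ℕ} (m : ℝ) (p : Mom n) : ℝ := Real.sqrt (‖p‖ ^ 2 + m ^ 2)

/-- The point `(ω_p, p)` of the upper mass shell. -/
def onShell {n : ℕ} (m : ℝ) (p : Mom n) : SpaceTime n :=
  WithLp.toLp 2 (Fin.cons (energy m p) fun i => p i)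

/-- The measure `dⁿp / (2 ω_p)`. -/
def shellMeasure (n : ℕ) (m : ℝ) : Measure (Mom n) :=
  (volume : Measure (Mom n)).withDensity fun p => ENNReal.ofReal ((2 * energy m p)⁻¹)

instance (n : ℕ) (m : ℝ) : SigmaFinite (shellMeasure n m) :=
  SigmaFinite.withDensity_ofReal _

/-- The one-particle Hilbert space `L²(ℝⁿ, dⁿp / (2 ω_p))`. -/
abbrev H1 (n : ℕ) (m : ℝ) : Type := OneParticle (shellMeasure n m)

lemma continuous_energy {n : ℕ} (m : ℝ) : Continuous (energy m : Mom n → ℝ) := by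
  unfold energy; fun_prop

lemma continuous_onShell {n : ℕ} (m : ℝ) : Continuous (onShell m : Mom n → SpaceTime n) := by
  refine (PiLp.continuous_toLp 2 _).comp (continuous_pi fun i => ?_)
  refine Fin.cases ?_ (fun j => ?_) i
  · simpa using continuous_energy m
  · simp only [Fin.cons_succ]; fun_prop

lemma continuous_lorentz {n : ℕ} (x : SpaceTime n) : Continuous (lorentz x) := by
  unfold lorentz; fun_prop

lemma memLp_phase {n : ℕ} {m : ℝ} (y : SpaceTime n) (ψ : H1 n m) :
    MemLp (fun p : Mom n => Complex.exp (Complex.I * lorentz y (onShell m p)) * ψ p) 2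
      (shellMeasure n m) := by
  refine (Lp.memLp ψ).of_le ?_ (Eventually.of_forall fun p => ?_)
  · refine Continuous.aestronglyMeasurable ?_ |>.mul (Lp.aestronglyMeasurable ψ)
    have := (continuous_lorentz y).comp (continuous_onShell (n := n) m)
    exact Complex.continuous_exp.comp
      (continuous_const.mul (Complex.continuous_ofReal.comp this))
  · rw [norm_mul, mul_comm Complex.I, Complex.norm_exp_ofReal_mul_I, one_mul]

/-- The action of a translation on one-particle vectors. -/
def translateFun {n : ℕ} {m : ℝ} (y : SpaceTime n) (ψ : H1 n m) : H1 n m :=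
  (memLp_phase y ψ).toLp _

lemma translateFun_neg {n : ℕ} {m : ℝ} (y z : SpaceTime n) (hyz : y + z = 0) (ψ : H1 n m) :
    translateFun y (translateFun z ψ) = ψ := by
  apply Lp.ext
  filter_upwards [(memLp_phase y (translateFun z ψ)).coeFn_toLp,
    (memLp_phase z ψ).coeFn_toLp] with p h1 h2
  rw [translateFun, h1, translateFun, h2, ← mul_assoc, ← Complex.exp_add]
  have : lorentz y (onShell m p) + lorentz z (onShell m p) = 0 := by
    obtain rfl : y = -z := eq_neg_of_add_eq_zero_left hyz
    simp [lorentz]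
  rw [← mul_add, ← Complex.ofReal_add, this]
  simp

/-- The unitary group `e^{i y·P}`, `y·P = y_μ P^μ`, on the one-particle space: multiplication by
`e^{i y·p}` with `p = (ω_p, p)`. -/
def translate1 {n : ℕ} {m : ℝ} (y : SpaceTime n) : H1 n m ≃ₗᵢ[ℂ] H1 n m where
  toFun := translateFun y
  invFun := translateFun (-y)
  left_inv ψ := translateFun_neg _ _ (by simp) ψ
  right_inv ψ := translateFun_neg _ _ (by simp) ψ
  map_add' ψ φ := by
    apply Lp.ext
    filter_upwards [(memLp_phase y (ψ + φ)).coeFn_toLp, (memLp_phase y ψ).coeFn_toLp,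
      (memLp_phase y φ).coeFn_toLp, Lp.coeFn_add (translateFun y ψ) (translateFun y φ),
      Lp.coeFn_add ψ φ] with p h1 h2 h3 h4 h5
    rw [h4, Pi.add_apply, translateFun, translateFun, translateFun, h1, h2, h3, h5, Pi.add_apply,
      mul_add]
  map_smul' c ψ := by
    apply Lp.ext
    filter_upwards [(memLp_phase y (c • ψ)).coeFn_toLp, (memLp_phase y ψ).coeFn_toLp,
      Lp.coeFn_smul c (translateFun y ψ), Lp.coeFn_smul c ψ] with p h1 h2 h4 h5
    rw [RingHom.id_apply, h4, Pi.smul_apply, translateFun, translateFun, h1, h2, h5, Pi.smul_apply,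
      smul_eq_mul, smul_eq_mul]
    ring
  norm_map' ψ := by
    change ‖translateFun y ψ‖ = ‖ψ‖
    rw [Lp.norm_def, Lp.norm_def]
    congr 1
    refine eLpNorm_congr_norm_ae ?_
    filter_upwards [(memLp_phase y ψ).coeFn_toLp] with p h1
    rw [translateFun, h1, norm_mul, mul_comm Complex.I, Complex.norm_exp_ofReal_mul_I, one_mul]

/-! ### Test functions on the mass shell and the free field -/

/-- `p ↦ ∫ dx f(x) e^{i s p·x}` with `p = (ω_p, p)` on the mass shell. -/
def shellFourier {n : ℕ} (m s : ℝ) (f : 𝓢(SpaceTime n, ℂ)) (p : Mom n) : ℂ :=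
  ∫ x : SpaceTime n, f x * Complex.exp (Complex.I * (s * lorentz (onShell m p) x : ℝ))

/-- The Euclidean frequency belonging to `e^{i s p·x}`. -/
def shellFreq {n : ℕ} (m s : ℝ) (p : Mom n) : SpaceTime n :=
  WithLp.toLp 2 (Fin.cons (-(s / (2 * Real.pi)) * energy m p) fun i => s / (2 * Real.pi) * p i)

lemma continuous_shellFreq {n : ℕ} (m s : ℝ) :
    Continuous (shellFreq m s : Mom n → SpaceTime n) := by
  refine (PiLp.continuous_toLp 2 _).comp (continuous_pi fun i => ?_)
  refine Fin.cases ?_ (fun j => ?_) i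
  · exact continuous_const.mul (continuous_energy m)
  · simp only [Fin.cons_succ]; fun_prop

lemma norm_shellFreq {n : ℕ} (m s : ℝ) (hs : |s| = 1) (p : Mom n) :
    ‖p‖ / (2 * Real.pi) ≤ ‖shellFreq m s p‖ := by
  have h : (‖p‖ / (2 * Real.pi)) ^ 2 ≤ ‖shellFreq m s p‖ ^ 2 := by
    rw [EuclideanSpace.norm_sq_eq, Fin.sum_univ_succ, div_pow, EuclideanSpace.norm_sq_eq]
    have hs2 : s ^ 2 = 1 := by rw [← sq_abs, hs, one_pow]
    have : ∑ i : Fin n, ‖shellFreq m s p i.succ‖ ^ 2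
        = (∑ i : Fin n, ‖p i‖ ^ 2) / (2 * Real.pi) ^ 2 := by
      rw [Finset.sum_div]
      refine Finset.sum_congr rfl fun i _ => ?_
      simp only [shellFreq, Fin.cons_succ, Real.norm_eq_abs, sq_abs]
      rw [mul_pow, div_pow, hs2]
      ring
    rw [this]
    exact le_add_of_nonneg_left (sq_nonneg _)
  exact le_of_sq_le_sq h (norm_nonneg _)

lemma shellFourier_eq {n : ℕ} (m s : ℝ) (f : 𝓢(SpaceTime n, ℂ)) (p : Mom n) :
    shellFourier m s f p = (𝓕 f) (shellFreq m s p) := by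
  rw [SchwartzMap.fourier_coe, Real.fourier_eq', shellFourier]
  congr 1
  ext x
  have : s * lorentz (onShell m p) x = -2 * Real.pi * ⟪x, shellFreq m s p⟫_ℝ := by
    have hpi : (Real.pi : ℝ) ≠ 0 := Real.pi_ne_zero
    rw [PiLp.inner_apply, Fin.sum_univ_succ]
    simp only [lorentz, onShell, shellFreq, Fin.cons_zero, Fin.cons_succ, RCLike.inner_apply,
      conj_trivial]
    have : ∑ i : Fin n, s / (2 * Real.pi) * p i * x i.succ
        = s / (2 * Real.pi) * ∑ i : Fin n, p i * x i.succ := by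
      rw [Finset.mul_sum]
      exact Finset.sum_congr rfl fun i _ => by ring
    rw [this]
    field_simp
    ring
  rw [this, smul_eq_mul, mul_comm Complex.I, mul_comm]

lemma shellMeasure_le (n : ℕ) {m : ℝ} (hm : 0 < m) :
    shellMeasure n m ≤ ENNReal.ofReal ((2 * m)⁻¹) • (volume : Measure (Mom n)) := by
  rw [← withDensity_const]
  refine withDensity_mono (Eventually.of_forall fun p => ENNReal.ofReal_le_ofReal ?_)
  have : m ≤ energy m p := Real.le_sqrt_of_sq_le (by nlinarith [sq_nonneg ‖p‖])
  gcongr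

lemma memLp_shellFourier {n : ℕ} {m : ℝ} (hm : 0 < m) {s : ℝ} (hs : |s| = 1)
    (f : 𝓢(SpaceTime n, ℂ)) : MemLp (shellFourier m s f) 2 (shellMeasure n m) := by
  refine MemLp.of_measure_le_smul ENNReal.ofReal_ne_top (shellMeasure_le n hm) ?_
  have hcont : Continuous (shellFourier m s f) := by
    have : shellFourier m s f = fun p => (𝓕 f) (shellFreq m s p) :=
      funext fun p => shellFourier_eq m s f p
    rw [this]
    exact (𝓕 f).continuous.comp (continuous_shellFreq m s)
  obtain ⟨C, hC⟩ : ∃ C : ℝ, ∀ x, (1 + ‖x‖) ^ (n + 1) * ‖(𝓕 f) x‖ ≤ C :=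
    ⟨_, fun x => by
      simpa using SchwartzMap.one_add_le_sup_seminorm_apply (𝕜 := ℂ) (m := (n + 1, 0))
        (k := n + 1) (n := 0) le_rfl le_rfl (𝓕 f) x⟩
  have hpi : (1 : ℝ) ≤ 2 * Real.pi := by nlinarith [Real.pi_gt_three]
  have hbound : ∀ p, ‖shellFourier m s f p‖ ≤
      ‖(C * (2 * Real.pi) ^ (n + 1)) * ((1 + ‖p‖) ^ (n + 1))⁻¹‖ := by
    intro p
    refine le_trans ?_ (le_abs_self _)
    rw [shellFourier_eq, ← div_eq_mul_inv, le_div_iff₀ (by positivity)]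
    have h1 : 1 + ‖p‖ ≤ (1 + ‖shellFreq m s p‖) * (2 * Real.pi) := by
      have := norm_shellFreq m s hs p
      rw [div_le_iff₀ (by positivity)] at this
      linarith
    calc ‖(𝓕 f) (shellFreq m s p)‖ * (1 + ‖p‖) ^ (n + 1)
        ≤ ‖(𝓕 f) (shellFreq m s p)‖ * ((1 + ‖shellFreq m s p‖) * (2 * Real.pi)) ^ (n + 1) := by
          gcongr
      _ = ((1 + ‖shellFreq m s p‖) ^ (n + 1) * ‖(𝓕 f) (shellFreq m s p)‖)
            * (2 * Real.pi) ^ (n + 1) := by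
          rw [mul_pow]; ring
      _ ≤ C * (2 * Real.pi) ^ (n + 1) := by gcongr; exact hC _
  refine MemLp.of_le (f := shellFourier m s f) ?_ hcont.aestronglyMeasurable
    (Eventually.of_forall hbound)
  refine MemLp.const_mul ?_ _
  have hm' : AEStronglyMeasurable (fun p : Mom n => ((1 + ‖p‖) ^ (n + 1))⁻¹) volume := by
    refine Continuous.aestronglyMeasurable (Continuous.inv₀ (by fun_prop) fun p => ?_)
    positivity
  rw [memLp_two_iff_integrable_sq hm']
  have hint := integrable_one_add_norm (E := Mom n) (μ := volume) (r := ((2 * (n + 1) : ℕ) : ℝ))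
    (by rw [finrank_euclideanSpace_fin]; push_cast; linarith)
  refine hint.congr (Eventually.of_forall fun p => ?_)
  simp only
  rw [Real.rpow_neg (by positivity), Real.rpow_natCast, inv_pow, ← pow_mul, mul_comm]

/-- The test function `f⁺(p) = ∫ dx f(x) e^{i p·x}` on the mass shell. -/
def testPlus {n : ℕ} {m : ℝ} (hm : 0 < m) (f : 𝓢(SpaceTime n, ℂ)) : H1 n m :=
  (memLp_shellFourier hm (s := 1) (by simp) f).toLp _

/-- The test function `f⁻(p) = ∫ dx f(x) e^{-i p·x}` on the mass shell. -/
def testMinus {n : ℕ} {m : ℝ} (hm : 0 < m) (f : 𝓢(SpaceTime n, ℂ)) : H1 n m :=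
  (memLp_shellFourier hm (s := -1) (by simp) f).toLp _

/-- The free scalar field `φ(f) = a(conj f⁻) + a*(f⁺)` of mass `m`. -/
def freeField {n : ℕ} {m : ℝ} (hm : 0 < m) (f : 𝓢(SpaceTime n, ℂ)) :
    finiteParticle (shellMeasure n m) →ₗ[ℂ] finiteParticle (shellMeasure n m) :=
  annihilate (star (testMinus hm f)) + create (testPlus hm f)

/-! ### The operator `X`, its domain, and the deformation -/

/-- The dense domain `Δ(P)` of rapidly decreasing one-particle vectors. -/
def DeltaP (n : ℕ) (m : ℝ) : Set (H1 n m) :=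
  {ψ | ∀ r : ℕ, ∃ c : ℝ, ∀ᵐ p ∂shellMeasure n m, ‖((‖p‖ ^ 2) ^ r : ℝ) * ψ p‖ ≤ c}

/-- `Δ_k(P)`, the `k`-fold (symmetric, algebraic) tensor power of `Δ(P)`, in the bosonic
`k`-particle space. -/
def DeltaPk (n : ℕ) (m : ℝ) (k : ℕ) : Submodule ℂ (finiteParticle (shellMeasure n m)) :=
  (Submodule.span ℂ {Ψ | ∃ f : Fin k → H1 n m, (∀ i, f i ∈ DeltaP n m) ∧ symVec f = Ψ}).map
    (inclSector (shellMeasure n m) k)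

/-- `Δ_k(X) = Γ(V⁻¹) Δ_k(P)`. -/
def DeltaXk {n : ℕ} {m : ℝ} (V : H1 n m ≃ₗᵢ[ℂ] H1 n m) (k : ℕ) :
    Submodule ℂ (finiteParticle (shellMeasure n m)) :=
  (DeltaPk n m k).map (secondQuant V.symm)

/-- The algebraic direct sum of the domains `Δ_k(X)`, `k = 0, 1, 2, …`. -/
def DeltaX {n : ℕ} {m : ℝ} (V : H1 n m ≃ₗᵢ[ℂ] H1 n m) :
    Submodule ℂ (finiteParticle (shellMeasure n m)) :=
  ⨆ k : ℕ, DeltaXk V k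

/-- The unitary group `V(y) = e^{i y·X} = Γ(V⁻¹) e^{i y·P} Γ(V)` generated by
`X_μ = Γ(V⁻¹) P_μ Γ(V)`, where `e^{i y·P} = Γ(e^{i y·p})` is the second quantized translation. -/
def groupX {n : ℕ} {m : ℝ} (V : H1 n m ≃ₗᵢ[ℂ] H1 n m) (y : SpaceTime n) :
    finiteParticle (shellMeasure n m) →ₗ[ℂ] finiteParticle (shellMeasure n m) :=
  secondQuant V.symm ∘ₗ secondQuant (translate1 y) ∘ₗ secondQuant V

/-- The adjoint action `β_y(A) = V(y) A V(y)⁻¹`, with `V(y)⁻¹ = V(-y)`. -/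
def adjointX {n : ℕ} {m : ℝ} (V : H1 n m ≃ₗᵢ[ℂ] H1 n m) (y : SpaceTime n)
    (A : finiteParticle (shellMeasure n m) →ₗ[ℂ] finiteParticle (shellMeasure n m)) :
    finiteParticle (shellMeasure n m) →ₗ[ℂ] finiteParticle (shellMeasure n m) :=
  groupX V y ∘ₗ A ∘ₗ groupX V (-y)

/-- Skew-symmetry of a real matrix with respect to the Lorentzian scalar product. -/
def IsLorentzSkew {n : ℕ} (θ : Matrix (Fin (n + 1)) (Fin (n + 1)) ℝ) : Prop :=
  ∀ x y : SpaceTime n,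
    lorentz (Matrix.toEuclideanLin θ x) y = -lorentz x (Matrix.toEuclideanLin θ y)

/-- The regularised integrand `e^{-i x·y} χ(εx, εy) β_{θx}(A) V(y) Φ`. -/
def warpIntegrand {n : ℕ} {m : ℝ} (θ : Matrix (Fin (n + 1)) (Fin (n + 1)) ℝ)
    (V : H1 n m ≃ₗᵢ[ℂ] H1 n m)
    (A : finiteParticle (shellMeasure n m) →ₗ[ℂ] finiteParticle (shellMeasure n m))
    (Φ : finiteParticle (shellMeasure n m)) (χ : 𝓢(SpaceTime n × SpaceTime n, ℂ)) (ε : ℝ)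
    (z : SpaceTime n × SpaceTime n) : Fock (shellMeasure n m) :=
  (Complex.exp (-Complex.I * lorentz z.1 z.2) * χ (ε • z)) •
    (adjointX V (Matrix.toEuclideanLin θ z.1) A (groupX V z.2 Φ) : Fock (shellMeasure n m))

/-- `A_{θ,X} Φ` is well defined as an oscillatory integral and equal to `Ξ`: for every Schwartz
cutoff `χ` with `χ(0,0) = 1` the regularised integrals exist for all `ε ≠ 0` and
`(2π)⁻ᵈ ∬ dx dy e^{-i x·y} χ(εx, εy) β_{θx}(A) V(y) Φ` converges in norm to `Ξ` as `ε → 0`. -/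
def IsWarped {n : ℕ} {m : ℝ} (θ : Matrix (Fin (n + 1)) (Fin (n + 1)) ℝ)
    (V : H1 n m ≃ₗᵢ[ℂ] H1 n m)
    (A : finiteParticle (shellMeasure n m) →ₗ[ℂ] finiteParticle (shellMeasure n m))
    (Φ : finiteParticle (shellMeasure n m)) (Ξ : Fock (shellMeasure n m)) : Prop :=
  ∀ χ : 𝓢(SpaceTime n × SpaceTime n, ℂ), χ (0, 0) = 1 →
    (∀ ε : ℝ, ε ≠ 0 → Integrable (warpIntegrand θ V A Φ χ ε)) ∧
    Tendsto (fun ε : ℝ => ((2 * Real.pi) ^ (n + 1))⁻¹ • ∫ z, warpIntegrand θ V A Φ χ ε z)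
      (𝓝[≠] 0) (𝓝 Ξ)

end DeformedField

end

/-!
With `J` the isometry for which `x·y = ⟪J x, y⟫`, the stationary point of the phase
`-x·y + x·q + Q·y` is `(Q, q)`. Substituting `x = Q + ε u`, `y = ε⁻¹ v` and integrating over `v`
first turns the regularized integral into an integral of Fourier transforms of the slices
`χ (x, ·)`, which are dominated by one integrable function uniformly in `ε` and in the momenta
`q, Q`; Fourier inversion identifies the limit as `(2π)^d e^{i Q·q}`.

On the `k`-particle sector, `V(θx) a*(h) V(θx)⁻¹ V(y) Φ` is a fixed bounded operator applied to a
wave function multiplied by such a phase in the particle momenta: after conjugation by `Γ(V)`,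
`q = -θ p₀` for the momentum `p₀` of the created particle and `Q = p₁ + ⋯ + p_k`. Fubini and
dominated convergence in `L²` thus yield the limit for every vector of finite particle number, as
multiplication by `e^{i Q·q}` followed by the same bounded operator. A phase does not change the
norm, so the bounds of the free field survive. Taking adjoints gives the annihilation operator;
there `Q` also contains `p₀`, which does not contribute since `p₀·θ p₀ = 0`.
-/

noncomputable section

namespace DeformedField

/-! ### The scalar oscillatory integral -/

section Slice

variable {E F G : Type*} [NormedAddCommGroup E] [NormedSpace ℝ E] [NormedAddCommGroup F]
  [NormedSpace ℝ F] [NormedAddCommGroup G] [NormedSpace ℝ G]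

lemma norm_iteratedFDeriv_slice_le (χ : 𝓢(E × F, G)) (x : E) (k l : ℕ) (y : F) :
    ‖y‖ ^ k * ‖iteratedFDeriv ℝ l (fun y => χ (x, y)) y‖ ≤ SchwartzMap.seminorm ℝ k l χ := by
  let ι := ContinuousLinearMap.inr ℝ E F
  have hslice : (fun y : F => χ (x, y)) = (fun z : E × F => χ ((x, 0) + z)) ∘ ι := by
    ext y
    simp [ι]
  have hsmooth : ContDiff ℝ l fun z : E × F => χ ((x, 0) + z) :=
    (χ.smooth l).comp (contDiff_const.add contDiff_id)
  have hι : ((x, 0) : E × F) + ι y = (x, y) := by simp [ι]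
  have hprod : ∏ _i : Fin l, ‖ι‖ ≤ 1 :=
    Finset.prod_le_one (fun _ _ => norm_nonneg _) fun _ _ =>
      ContinuousLinearMap.norm_inr_le_one ℝ E F
  rw [hslice, ι.iteratedFDeriv_comp_right hsmooth y le_rfl, iteratedFDeriv_comp_add_left, hι]
  refine le_trans ?_ (χ.le_seminorm ℝ k l (x, y))
  gcongr
  · exact norm_snd_le (x, y)
  · exact ((iteratedFDeriv ℝ l χ (x, y)).norm_compContinuousLinearMap_le fun _ => ι).trans
      (mul_le_of_le_one_right (norm_nonneg _) hprod)

/-- The partial function `y ↦ χ (x, y)` of a Schwartz function, as a Schwartz function; the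
oscillatory integral is computed from the Fourier transforms of these slices. -/
def slice (χ : 𝓢(E × F, G)) (x : E) : 𝓢(F, G) where
  toFun y := χ (x, y)
  smooth' := (χ.smooth ⊤).comp (contDiff_const.prodMk contDiff_id)
  decay' k l := ⟨_, norm_iteratedFDeriv_slice_le χ x k l⟩

@[simp] lemma slice_apply (χ : 𝓢(E × F, G)) (x : E) (y : F) : slice χ x y = χ (x, y) := rfl

lemma seminorm_slice_le (χ : 𝓢(E × F, G)) (x : E) (k l : ℕ) :
    SchwartzMap.seminorm ℝ k l (slice χ x) ≤ SchwartzMap.seminorm ℝ k l χ :=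
  (slice χ x).seminorm_le_bound ℝ k l (apply_nonneg _ _) (norm_iteratedFDeriv_slice_le χ x k l)

variable {F' G' : Type*} [NormedAddCommGroup F'] [NormedSpace ℝ F'] [NormedAddCommGroup G']
  [NormedSpace ℝ G']

lemma exists_one_add_norm_pow_mul_norm_slice_le (T : 𝓢(F, G) →L[ℝ] 𝓢(F', G'))
    (χ : 𝓢(E × F, G)) (N : ℕ) :
    ∃ C : ℝ, ∀ x ξ, (1 + ‖ξ‖) ^ N * ‖T (slice χ x) ξ‖ ≤ C := by
  let p : Seminorm ℝ 𝓢(F', G') :=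
    (Finset.Iic (N, 0)).sup fun m => SchwartzMap.seminorm ℝ m.1 m.2
  have hp : Continuous p :=
    (schwartz_withSeminorms ℝ F' G').finset_sups.continuous_seminorm (Finset.Iic (N, 0))
  obtain ⟨s, C, -, hC⟩ := Seminorm.bound_of_continuous (schwartz_withSeminorms ℝ F G)
    (p.comp T.toLinearMap) (hp.comp T.continuous)
  have hslice (x : E) : s.sup (schwartzSeminormFamily ℝ F G) (slice χ x)
      ≤ s.sup (schwartzSeminormFamily ℝ (E × F) G) χ :=
    Seminorm.finset_sup_apply_le (apply_nonneg _ _) fun i hi =>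
      (seminorm_slice_le χ x i.1 i.2).trans
        (Seminorm.le_finset_sup_apply (p := schwartzSeminormFamily ℝ (E × F) G) hi)
  refine ⟨2 ^ N * (C * s.sup (schwartzSeminormFamily ℝ (E × F) G) χ), fun x ξ => ?_⟩
  calc (1 + ‖ξ‖) ^ N * ‖T (slice χ x) ξ‖
      ≤ 2 ^ N * p (T (slice χ x)) := by
        simpa only [norm_iteratedFDeriv_zero] using SchwartzMap.one_add_le_sup_seminorm_apply
          (𝕜 := ℝ) (m := (N, 0)) (k := N) (n := 0) le_rfl le_rfl (T (slice χ x)) ξ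
    _ ≤ 2 ^ N * (C * s.sup (schwartzSeminormFamily ℝ (E × F) G) χ) := by
        gcongr
        exact (hC (slice χ x)).trans (mul_le_mul_of_nonneg_left (hslice x) C.2)

lemma exists_integrable_bound_slice [MeasurableSpace F'] (μ : Measure F') [μ.HasTemperateGrowth]
    (T : 𝓢(F, G) →L[ℝ] 𝓢(F', G')) (χ : 𝓢(E × F, G)) :
    ∃ b : F' → ℝ, Integrable b μ ∧ ∀ x ξ, ‖T (slice χ x) ξ‖ ≤ b ξ := by
  obtain ⟨C, hC⟩ := exists_one_add_norm_pow_mul_norm_slice_le T χ μ.integrablePower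
  refine ⟨_, μ.integrable_pow_neg_integrablePower.const_mul C, fun x ξ => ?_⟩
  rw [Real.rpow_neg (by positivity), Real.rpow_natCast, ← div_eq_mul_inv,
    le_div_iff₀ (by positivity), mul_comm]
  exact hC x ξ

end Slice

section SliceFourier

variable {E F G : Type*} [NormedAddCommGroup E] [NormedSpace ℝ E] [NormedAddCommGroup F]
  [InnerProductSpace ℝ F] [FiniteDimensional ℝ F] [MeasurableSpace F] [BorelSpace F]
  [NormedAddCommGroup G] [NormedSpace ℂ G]

lemma exists_integrable_bound_fourier_slice (χ : 𝓢(E × F, G)) :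
    ∃ b : F → ℝ, Integrable b ∧ ∀ x ξ, ‖𝓕 (slice χ x) ξ‖ ≤ b ξ :=
  exists_integrable_bound_slice volume (FourierTransform.fourierCLM ℝ 𝓢(F, G)) χ

lemma continuous_fourier_slice (χ : 𝓢(E × F, G)) :
    Continuous fun z : E × F => 𝓕 (slice χ z.1) z.2 := by
  obtain ⟨b, hb, hχb⟩ := exists_integrable_bound_slice volume (.id ℝ 𝓢(F, G)) χ
  have hχ := χ.continuous
  simp_rw [SchwartzMap.fourier_coe, Real.fourier_eq', slice_apply]
  refine continuous_of_dominated (fun z => ?_) (fun z => Eventually.of_forall fun y => ?_) hb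
    (Eventually.of_forall fun y => by fun_prop)
  · exact Continuous.aestronglyMeasurable (by fun_prop)
  · rw [norm_smul, Complex.norm_exp_ofReal_mul_I, one_mul]
    exact hχb z.1 y

end SliceFourier

lemma integral_integral_affine {E G : Type*} [NormedAddCommGroup E] [NormedSpace ℝ E]
    [FiniteDimensional ℝ E] [MeasurableSpace E] [BorelSpace E] [NormedAddCommGroup G]
    [NormedSpace ℝ G] (μ : Measure E) [μ.IsAddHaarMeasure] (f : E → E → G) (a : E) {ε : ℝ}
    (hε : ε ≠ 0) :
    ∫ x, ∫ y, f x y ∂μ ∂μ = ∫ u, ∫ v, f (a + ε • u) (ε⁻¹ • v) ∂μ ∂μ := by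
  simp_rw [fun u => μ.integral_comp_inv_smul (f (a + ε • u)) ε]
  rw [integral_smul, μ.integral_comp_smul (fun x => ∫ y, f (a + x) y ∂μ) ε,
    integral_add_left_eq_self (fun x => ∫ y, f x y ∂μ) a, smul_smul, abs_inv,
    mul_inv_cancel₀ (by positivity), one_smul]

section OscillatoryIntegral

variable {E : Type*} [NormedAddCommGroup E] [InnerProductSpace ℝ E] (J : E ≃ₗᵢ[ℝ] E)
  (χ : 𝓢(E × E, ℂ))

/-- The regularized oscillating weight `e^{-i x·y} χ(εx, εy)`. The nondegenerate bilinear form is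
encoded by the isometry `J`, as `x·y = ⟪J x, y⟫`. -/
def oscWeight (ε : ℝ) (z : E × E) : ℂ :=
  Complex.exp (-Complex.I * (⟪J z.1, z.2⟫_ℝ : ℝ)) * χ (ε • z)

/-- The phase `x·q + Q·y` at `z = (x, y)`, for the bilinear form `⟪J x, y⟫`. -/
def oscPhase (q Q : E) (z : E × E) : ℝ := ⟪J z.1, q⟫_ℝ + ⟪J Q, z.2⟫_ℝ

lemma norm_oscWeight (ε : ℝ) (z : E × E) : ‖oscWeight J χ ε z‖ = ‖χ (ε • z)‖ := by
  simp [oscWeight, Complex.norm_exp]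

@[fun_prop]
lemma continuous_oscWeight (ε : ℝ) : Continuous (oscWeight J χ ε) := by
  have hχ := χ.continuous
  unfold oscWeight
  fun_prop

@[fun_prop]
lemma continuous_oscPhase (q Q : E) : Continuous (oscPhase J q Q) := by
  unfold oscPhase
  fun_prop

variable [FiniteDimensional ℝ E] [MeasurableSpace E] [BorelSpace E]

instance isAddHaarMeasure_volume_prod : (volume : Measure (E × E)).IsAddHaarMeasure :=
  Measure.prod.instIsAddHaarMeasure _ _

/-- The regularized integral `∬ e^{-i x·y} χ(εx, εy) e^{i (x·q + Q·y)} dx dy`. -/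
def oscIntegral (ε : ℝ) (q Q : E) : ℂ :=
  ∫ z : E × E, oscWeight J χ ε z * Complex.exp (oscPhase J q Q z * Complex.I)

lemma integrable_oscWeight {ε : ℝ} (hε : ε ≠ 0) : Integrable (oscWeight J χ ε) := by
  have hχ : Integrable fun z : E × E => χ (ε • z) :=
    (χ.integrable (μ := volume)).comp_smul hε
  exact hχ.congr' (continuous_oscWeight J χ ε).aestronglyMeasurable
    (Eventually.of_forall fun z => (norm_oscWeight J χ ε z).symm)

lemma integrable_oscWeight_mul_exp_oscPhase {ε : ℝ} (hε : ε ≠ 0) (q Q : E) :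
    Integrable fun z : E × E =>
      oscWeight J χ ε z * Complex.exp (oscPhase J q Q z * Complex.I) := by
  refine (integrable_oscWeight J χ hε).congr'
    (Continuous.aestronglyMeasurable (by fun_prop)) (Eventually.of_forall fun z => ?_)
  rw [norm_mul, Complex.norm_exp_ofReal_mul_I, mul_one]

lemma oscIntegral_eq_integral_fourier_slice {ε : ℝ} (hε : ε ≠ 0) (q Q : E) :
    oscIntegral J χ ε q Q = ∫ u : E, Complex.exp ((⟪J (Q + ε • u), q⟫_ℝ : ℝ) * Complex.I) *
      𝓕 (slice χ (ε • (Q + ε • u))) ((2 * Real.pi)⁻¹ • J u) := by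
  rw [oscIntegral, Measure.volume_eq_prod,
    integral_prod _ (integrable_oscWeight_mul_exp_oscPhase J χ hε q Q),
    integral_integral_affine volume (fun x y => oscWeight J χ ε (x, y) *
      Complex.exp (oscPhase J q Q (x, y) * Complex.I)) Q hε]
  refine integral_congr_ae (Eventually.of_forall fun u => ?_)
  simp only [SchwartzMap.fourier_coe, Real.fourier_eq', ← integral_const_mul]
  refine integral_congr_ae (Eventually.of_forall fun v => ?_)
  have hpoint : ε • ((Q + ε • u, ε⁻¹ • v) : E × E) = (ε • (Q + ε • u), v) := by
    rw [Prod.smul_mk, smul_inv_smul₀ hε]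
  have hphase : -⟪J (Q + ε • u), ε⁻¹ • v⟫_ℝ + oscPhase J q Q (Q + ε • u, ε⁻¹ • v)
      = ⟪J (Q + ε • u), q⟫_ℝ + -2 * Real.pi * ⟪v, (2 * Real.pi)⁻¹ • J u⟫_ℝ := by
    simp only [oscPhase, map_add, map_smul, inner_add_left, real_inner_smul_left,
      real_inner_smul_right, real_inner_comm (J u) v]
    field_simp
    ring
  simp only [oscWeight, hpoint, slice_apply, smul_eq_mul]
  rw [mul_right_comm, ← Complex.exp_add, ← mul_assoc, ← Complex.exp_add]
  congr 2
  have := congrArg (fun r : ℝ => (r : ℂ) * Complex.I) hphase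
  push_cast at this ⊢
  linear_combination this

lemma exists_integrable_bound_fourier_slice_comp :
    ∃ b : E → ℝ, Integrable b ∧
      ∀ x u, ‖𝓕 (slice χ x) ((2 * Real.pi)⁻¹ • J u)‖ ≤ b u := by
  obtain ⟨b, hb, hχb⟩ := exists_integrable_bound_fourier_slice χ
  have hbJ : Integrable fun u => b ((2 * Real.pi)⁻¹ • J u) :=
    (J.measurePreserving.integrable_comp_emb J.toHomeomorph.measurableEmbedding
      (g := fun u => b ((2 * Real.pi)⁻¹ • u))).2 (hb.comp_smul (by positivity))
  exact ⟨_, hbJ, fun x u => hχb x _⟩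

lemma exists_norm_oscIntegral_le :
    ∃ C : ℝ, ∀ ε : ℝ, ε ≠ 0 → ∀ q Q, ‖oscIntegral J χ ε q Q‖ ≤ C := by
  obtain ⟨b, hb, hχb⟩ := exists_integrable_bound_fourier_slice_comp J χ
  refine ⟨∫ u, b u, fun ε hε q Q => ?_⟩
  rw [oscIntegral_eq_integral_fourier_slice J χ hε]
  refine norm_integral_le_of_norm_le hb (Eventually.of_forall fun u => ?_)
  rw [norm_mul, Complex.norm_exp_ofReal_mul_I, one_mul]
  exact hχb _ u

lemma integral_fourier_comp_isometry {G : Type*} [NormedAddCommGroup G] [NormedSpace ℂ G]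
    [CompleteSpace G] (g : 𝓢(E, G)) :
    ∫ u, 𝓕 g ((2 * Real.pi)⁻¹ • J u) = (2 * Real.pi) ^ Module.finrank ℝ E • g 0 := by
  have hinv : ∫ ξ, 𝓕 g ξ = g 0 := by
    have h : 𝓕⁻ (𝓕 g) 0 = g 0 := by rw [FourierTransform.fourierInv_fourier_eq]
    rw [SchwartzMap.fourierInv_coe, Real.fourierInv_eq'] at h
    simpa only [inner_zero_right, mul_zero, Complex.ofReal_zero, zero_mul, Complex.exp_zero,
      one_smul] using h
  rw [J.measurePreserving.integral_comp J.toHomeomorph.measurableEmbedding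
      fun u => 𝓕 g ((2 * Real.pi)⁻¹ • u),
    Measure.integral_comp_inv_smul, abs_of_pos (by positivity), hinv]

lemma tendsto_oscIntegral (q Q : E) :
    Tendsto (fun ε : ℝ => oscIntegral J χ ε q Q) (𝓝[≠] 0)
      (𝓝 ((2 * Real.pi) ^ Module.finrank ℝ E * χ (0, 0) *
        Complex.exp ((⟪J Q, q⟫_ℝ : ℝ) * Complex.I))) := by
  obtain ⟨b, hb, hχb⟩ := exists_integrable_bound_fourier_slice_comp J χ
  let f (ε : ℝ) (u : E) : ℂ := Complex.exp ((⟪J (Q + ε • u), q⟫_ℝ : ℝ) * Complex.I) *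
    𝓕 (slice χ (ε • (Q + ε • u))) ((2 * Real.pi)⁻¹ • J u)
  have hf : Continuous fun w : ℝ × E => f w.1 w.2 := by
    have h𝓕 := (continuous_fourier_slice χ).comp (f := fun w : ℝ × E =>
      (w.1 • (Q + w.1 • w.2), (2 * Real.pi)⁻¹ • J w.2)) (by fun_prop)
    exact Continuous.mul (by fun_prop) h𝓕
  have hlim : Tendsto (fun ε => ∫ u, f ε u) (𝓝 0) (𝓝 (∫ u, f 0 u)) := by
    refine tendsto_integral_filter_of_dominated_convergence b
      (Eventually.of_forall fun ε => Continuous.aestronglyMeasurable (by fun_prop))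
      (Eventually.of_forall fun ε => Eventually.of_forall fun u => ?_) hb
      (Eventually.of_forall fun u => ?_)
    · rw [norm_mul, Complex.norm_exp_ofReal_mul_I, one_mul]
      exact hχb _ u
    · exact Continuous.tendsto (f := fun ε => f ε u) (by fun_prop) 0
  have hzero : ∫ u, f 0 u = (2 * Real.pi) ^ Module.finrank ℝ E * χ (0, 0) *
      Complex.exp ((⟪J Q, q⟫_ℝ : ℝ) * Complex.I) := by
    simp only [f, zero_smul, add_zero]
    rw [integral_const_mul, integral_fourier_comp_isometry, slice_apply, Complex.real_smul,
      mul_comm]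
    push_cast
    rfl
  rw [← hzero]
  refine (hlim.mono_left nhdsWithin_le_nhds).congr' ?_
  filter_upwards [self_mem_nhdsWithin] with ε hε
  exact (oscIntegral_eq_integral_fourier_slice J χ hε q Q).symm

end OscillatoryIntegral

/-! ### Multiplication by phases -/

lemma norm_integral_mul_exp_le {Z : Type*} [MeasurableSpace Z] {ρ : Measure Z} (w : Z → ℂ)
    (r : Z → ℝ) : ‖∫ z, w z * Complex.exp (r z * Complex.I) ∂ρ‖ ≤ ∫ z, ‖w z‖ ∂ρ := by
  refine (norm_integral_le_integral_norm _).trans_eq ?_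
  simp only [norm_mul, Complex.norm_exp_ofReal_mul_I, mul_one]

section Phase

variable {β : Type*} [MeasurableSpace β] {ν : Measure β}

lemma tendsto_Lp_of_dominated {G ι : Type*} [NormedAddCommGroup G] {p : ℝ≥0∞} [Fact (1 ≤ p)]
    (hp : p ≠ ∞) {l : Filter ι} [l.IsCountablyGenerated] {F : ι → Lp G p ν} {F₀ : Lp G p ν}
    {f : ι → β → G} {f₀ : β → G} {bound : β → ℝ} (hF : ∀ᶠ i in l, F i =ᵐ[ν] f i)
    (hF₀ : F₀ =ᵐ[ν] f₀) (hbound : MemLp bound p ν)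
    (hle : ∀ᶠ i in l, ∀ᵐ b ∂ν, ‖f i b - f₀ b‖ ≤ bound b)
    (hlim : ∀ᵐ b ∂ν, Tendsto (fun i => f i b) l (𝓝 (f₀ b))) : Tendsto F l (𝓝 F₀) := by
  have hp0 : p ≠ 0 := (zero_lt_one.trans_le Fact.out).ne'
  have hp_pos : 0 < p.toReal := ENNReal.toReal_pos hp0 hp
  have hsub : ∀ᶠ i in l, (F i - F₀ : β → G) =ᵐ[ν] f i - f₀ :=
    hF.mono fun i hi => hi.sub hF₀
  have hlint : Tendsto (fun i => ∫⁻ b, ‖(F i - F₀ : β → G) b‖ₑ ^ p.toReal ∂ν) l (𝓝 0) := by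
    rw [← lintegral_zero (μ := ν)]
    refine (tendsto_lintegral_filter_of_dominated_convergence'
      (F := fun i b => ‖(f i - f₀) b‖ₑ ^ p.toReal) (fun b => ‖bound b‖ₑ ^ p.toReal)
      ?_ ?_ (lintegral_rpow_enorm_lt_top_of_eLpNorm_lt_top hp0 hp hbound.2).ne ?_).congr' ?_
    · filter_upwards [hsub] with i hi
      exact (((Lp.aestronglyMeasurable (F i)).sub
        (Lp.aestronglyMeasurable F₀)).congr hi).enorm.pow_const _
    · filter_upwards [hle] with i hi
      filter_upwards [hi] with b hb
      gcongr
      exact enorm_le_iff_norm_le.2 (hb.trans (Real.le_norm_self _))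
    · filter_upwards [hlim] with b hb
      have h0 : Tendsto (fun i => (f i - f₀) b) l (𝓝 0) := by
        simpa only [Pi.sub_apply, sub_self] using hb.sub_const (f₀ b)
      simpa only [enorm_zero, ENNReal.zero_rpow_of_pos hp_pos]
        using h0.enorm.ennrpow_const p.toReal
    · filter_upwards [hsub] with i hi
      exact lintegral_congr_ae (hi.mono fun b hb => by simp only [hb])
  rw [Lp.tendsto_Lp_iff_tendsto_eLpNorm']
  simp_rw [eLpNorm_eq_lintegral_rpow_enorm_toReal hp0 hp]
  simpa only [ENNReal.zero_rpow_of_pos (inv_pos.2 hp_pos), one_div]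
    using hlint.ennrpow_const p.toReal⁻¹

variable {p : ℝ≥0∞}

lemma memLp_phaseMul {s : β → ℝ} (hs : Measurable s) (ψ : Lp ℂ p ν) :
    MemLp (fun b => Complex.exp (s b * Complex.I) * ψ b) p ν := by
  refine (Lp.memLp ψ).of_le ?_ (Eventually.of_forall fun b => ?_)
  · exact (Measurable.aestronglyMeasurable (by fun_prop)).mul (Lp.aestronglyMeasurable ψ)
  · rw [norm_mul, Complex.norm_exp_ofReal_mul_I, one_mul]

variable [Fact (1 ≤ p)]

/-- Multiplication by the phase `e^{i s}`, as an isometry of `Lᵖ`. Translations act in this way on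
the one particle space and on every sector. -/
def phaseMul {s : β → ℝ} (hs : Measurable s) : Lp ℂ p ν →ₗᵢ[ℂ] Lp ℂ p ν where
  toFun ψ := (memLp_phaseMul hs ψ).toLp _
  map_add' ψ φ := by
    rw [← MemLp.toLp_add]
    refine MemLp.toLp_congr _ _ ?_
    filter_upwards [Lp.coeFn_add ψ φ] with b hb
    rw [hb, Pi.add_apply, mul_add, Pi.add_apply]
  map_smul' c ψ := by
    rw [RingHom.id_apply, ← MemLp.toLp_const_smul]
    refine MemLp.toLp_congr _ _ ?_
    filter_upwards [Lp.coeFn_smul c ψ] with b hb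
    rw [hb, Pi.smul_apply, Pi.smul_apply, mul_smul_comm]
  norm_map' ψ := by
    refine (Lp.norm_toLp _ (memLp_phaseMul hs ψ)).trans ?_
    rw [Lp.norm_def]
    refine congrArg _ (eLpNorm_congr_norm_ae (Eventually.of_forall fun b => ?_))
    rw [norm_mul, Complex.norm_exp_ofReal_mul_I, one_mul]

lemma coeFn_phaseMul {s : β → ℝ} (hs : Measurable s) (ψ : Lp ℂ p ν) :
    phaseMul hs ψ =ᵐ[ν] fun b => Complex.exp (s b * Complex.I) * ψ b :=
  (memLp_phaseMul hs ψ).coeFn_toLp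

lemma phaseMul_congr {s t : β → ℝ} (hs : Measurable s) (ht : Measurable t)
    (hst : ∀ b, s b = t b) (ψ : Lp ℂ p ν) : phaseMul hs ψ = phaseMul ht ψ := by
  obtain rfl : s = t := funext hst
  rfl

lemma phaseMul_phaseMul {s t : β → ℝ} (hs : Measurable s) (ht : Measurable t) (ψ : Lp ℂ p ν) :
    phaseMul hs (phaseMul ht ψ) = phaseMul (hs.add ht) ψ := by
  apply Lp.ext
  filter_upwards [coeFn_phaseMul hs (phaseMul ht ψ), coeFn_phaseMul ht ψ,
    coeFn_phaseMul (hs.add ht) ψ] with b h_left h_inner h_right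
  rw [h_left, h_inner, h_right, ← mul_assoc, ← Complex.exp_add, Pi.add_apply, Complex.ofReal_add,
    add_mul]

lemma phaseMul_zero (ψ : Lp ℂ p ν) : phaseMul (measurable_const (a := (0 : ℝ))) ψ = ψ := by
  apply Lp.ext
  filter_upwards [coeFn_phaseMul (measurable_const (a := (0 : ℝ))) ψ] with b hb
  rw [hb, Complex.ofReal_zero, zero_mul, Complex.exp_zero, one_mul]

lemma inner_phaseMul_neg_left {s : β → ℝ} (hs : Measurable s) (ψ φ : Lp ℂ 2 ν) :
    ⟪phaseMul hs.neg ψ, φ⟫_ℂ = ⟪ψ, phaseMul hs φ⟫_ℂ := by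
  have h : phaseMul hs (phaseMul hs.neg ψ) = ψ := by
    simp only [phaseMul_phaseMul, add_neg_cancel]
    exact phaseMul_zero ψ
  rw [← LinearIsometry.inner_map_map (phaseMul hs) (phaseMul hs.neg ψ), h]

lemma continuous_phaseMul {Z : Type*} [TopologicalSpace Z] [FirstCountableTopology Z]
    (hp : p ≠ ∞) {s : Z → β → ℝ} (hs : ∀ z, Measurable (s z)) (hsc : ∀ b, Continuous fun z => s z b)
    (ψ : Lp ℂ p ν) : Continuous fun z => phaseMul (hs z) ψ := by
  refine continuous_iff_continuousAt.2 fun z₀ => ?_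
  refine tendsto_Lp_of_dominated hp (Eventually.of_forall fun z => coeFn_phaseMul (hs z) ψ)
    (coeFn_phaseMul (hs z₀) ψ) ((Lp.memLp ψ).norm.const_mul 2)
    (Eventually.of_forall fun z => Eventually.of_forall fun b => ?_)
    (Eventually.of_forall fun b => ?_)
  · rw [← sub_mul, norm_mul]
    gcongr
    refine (norm_sub_le _ _).trans ?_
    rw [Complex.norm_exp_ofReal_mul_I, Complex.norm_exp_ofReal_mul_I, one_add_one_eq_two]
  · have := hsc b
    exact Continuous.tendsto (f := fun z => Complex.exp (s z b * Complex.I) * ψ b)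
      (by fun_prop) z₀

section Superposition

variable {Z : Type*} [MeasurableSpace Z] {ρ : Measure Z} {w : Z → ℂ} {s : Z → β → ℝ}

lemma integrable_mul_exp_mul_prod (hw : Integrable w ρ)
    (hs : Measurable (Function.uncurry s)) {f : β → ℂ} (hf : Integrable f ν) :
    Integrable (fun y : Z × β => w y.1 * Complex.exp (s y.1 y.2 * Complex.I) * f y.2)
      (ρ.prod ν) := by
  have hdom : Integrable (fun y : Z × β => w y.1 * f y.2) (ρ.prod ν) := hw.mul_prod hf
  have hmeas : Measurable fun y : Z × β => Complex.exp (s y.1 y.2 * Complex.I) := by fun_prop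
  refine (hdom.congr' (hmeas.aestronglyMeasurable.mul hdom.aestronglyMeasurable)
    (Eventually.of_forall fun y => ?_)).congr (Eventually.of_forall fun y => ?_)
  · simp only [Pi.mul_apply, norm_mul, Complex.norm_exp_ofReal_mul_I, one_mul]
  · simp only [Pi.mul_apply]
    ring

lemma coeFn_integral_smul_phaseMul [SFinite ρ] [SFinite ν] (hw : Integrable w ρ)
    (hs : Measurable (Function.uncurry s)) {ψ : Lp ℂ 2 ν}
    (hψ : Integrable (fun z => w z • phaseMul (hs.of_uncurry_left (x := z)) ψ) ρ) :
    (∫ z, w z • phaseMul (hs.of_uncurry_left (x := z)) ψ ∂ρ : Lp ℂ 2 ν) =ᵐ[ν]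
      fun b => (∫ z, w z * Complex.exp (s z b * Complex.I) ∂ρ) * ψ b := by
  have hmeas : AEStronglyMeasurable
      (fun b => ∫ z, w z * Complex.exp (s z b * Complex.I) ∂ρ) ν := by
    have hexp : Measurable fun y : β × Z => Complex.exp (s y.2 y.1 * Complex.I) := by fun_prop
    exact (hw.aestronglyMeasurable.comp_snd.mul hexp.aestronglyMeasurable).integral_prod_right'
  have hm : MemLp (fun b => (∫ z, w z * Complex.exp (s z b * Complex.I) ∂ρ) * ψ b) 2 ν := by
    refine (Lp.memLp ψ).of_le_mul (c := ∫ z, ‖w z‖ ∂ρ) (hmeas.mul (Lp.aestronglyMeasurable ψ))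
      (Eventually.of_forall fun b => ?_)
    rw [norm_mul]
    exact mul_le_mul_of_nonneg_right (norm_integral_mul_exp_le w fun z => s z b) (norm_nonneg _)
  suffices h : ∫ z, w z • phaseMul (hs.of_uncurry_left (x := z)) ψ ∂ρ = hm.toLp _ by
    rw [h]
    exact hm.coeFn_toLp
  refine ext_inner_left ℂ fun φ => ?_
  let c (b : β) : ℂ := ⟪φ b, ψ b⟫_ℂ
  have hc : Integrable c ν := L2.integrable_inner φ ψ
  calc ⟪φ, ∫ z, w z • phaseMul (hs.of_uncurry_left (x := z)) ψ ∂ρ⟫_ℂ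
      = ∫ z, ⟪φ, w z • phaseMul (hs.of_uncurry_left (x := z)) ψ⟫_ℂ ∂ρ := (integral_inner hψ φ).symm
    _ = ∫ z, ∫ b, w z * Complex.exp (s z b * Complex.I) * c b ∂ν ∂ρ := by
        refine integral_congr_ae (Eventually.of_forall fun z => ?_)
        simp only [inner_smul_right, L2.inner_def, ← integral_const_mul]
        refine integral_congr_ae ?_
        filter_upwards [coeFn_phaseMul (hs.of_uncurry_left (x := z)) ψ] with b hb
        simp only [hb, c, RCLike.inner_apply]
        ring
    _ = ∫ b, ∫ z, w z * Complex.exp (s z b * Complex.I) * c b ∂ρ ∂ν :=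
        integral_integral_swap (integrable_mul_exp_mul_prod hw hs hc)
    _ = ⟪φ, hm.toLp _⟫_ℂ := by
        rw [L2.inner_def]
        refine integral_congr_ae ?_
        filter_upwards [hm.coeFn_toLp] with b hb
        simp only [hb, integral_mul_const, c, RCLike.inner_apply]
        ring

end Superposition

end Phase

section OscillatoryPhase

variable {E : Type*} [NormedAddCommGroup E] [InnerProductSpace ℝ E] [FiniteDimensional ℝ E]
  [MeasurableSpace E] [BorelSpace E] (J : E ≃ₗᵢ[ℝ] E) (χ : 𝓢(E × E, ℂ))
  {β : Type*} [MeasurableSpace β] {ν : Measure β} {q Q : β → E} {ε : ℝ}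

lemma measurable_uncurry_oscPhase (hq : Measurable q) (hQ : Measurable Q) :
    Measurable (Function.uncurry fun (z : E × E) b => oscPhase J (q b) (Q b) z) := by
  have h : Continuous fun v : (E × E) × E × E => oscPhase J v.2.1 v.2.2 v.1 := by
    unfold oscPhase
    fun_prop
  exact h.measurable.comp
    (measurable_fst.prodMk ((hq.comp measurable_snd).prodMk (hQ.comp measurable_snd)))

lemma measurable_oscPhase (hq : Measurable q) (hQ : Measurable Q) (z : E × E) :
    Measurable fun b => oscPhase J (q b) (Q b) z :=
  (measurable_uncurry_oscPhase J hq hQ).of_uncurry_left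

lemma measurable_stationaryPhase (hq : Measurable q) (hQ : Measurable Q) :
    Measurable fun b => ⟪J (Q b), q b⟫_ℝ :=
  (J.continuous.measurable.comp hQ).inner hq

lemma integrable_oscWeight_smul_phaseMul (hε : ε ≠ 0) (hq : Measurable q) (hQ : Measurable Q)
    (ψ : Lp ℂ 2 ν) :
    Integrable fun z => oscWeight J χ ε z • phaseMul (measurable_oscPhase J hq hQ z) ψ := by
  have hcont : Continuous fun z => phaseMul (measurable_oscPhase J hq hQ z) ψ :=
    continuous_phaseMul ENNReal.ofNat_ne_top _ (fun b => continuous_oscPhase J (q b) (Q b)) ψ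
  refine ((integrable_oscWeight J χ hε).norm.mul_const ‖ψ‖).mono'
    ((continuous_oscWeight J χ ε).smul hcont).aestronglyMeasurable
    (Eventually.of_forall fun z => ?_)
  rw [norm_smul, LinearIsometry.norm_map]

lemma coeFn_integral_oscWeight_smul_phaseMul [SFinite ν] (hε : ε ≠ 0) (hq : Measurable q)
    (hQ : Measurable Q) (ψ : Lp ℂ 2 ν) :
    (∫ z, oscWeight J χ ε z • phaseMul (measurable_oscPhase J hq hQ z) ψ : Lp ℂ 2 ν) =ᵐ[ν]
      fun b => oscIntegral J χ ε (q b) (Q b) * ψ b :=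
  coeFn_integral_smul_phaseMul (integrable_oscWeight J χ hε)
    (measurable_uncurry_oscPhase J hq hQ)
    (integrable_oscWeight_smul_phaseMul J χ hε hq hQ ψ)

lemma tendsto_integral_oscWeight_smul_phaseMul [SFinite ν] (hχ : χ (0, 0) = 1)
    (hq : Measurable q) (hQ : Measurable Q) (ψ : Lp ℂ 2 ν) :
    Tendsto (fun ε : ℝ => ((2 * Real.pi) ^ Module.finrank ℝ E)⁻¹ •
        ∫ z, oscWeight J χ ε z • phaseMul (measurable_oscPhase J hq hQ z) ψ)
      (𝓝[≠] 0) (𝓝 (phaseMul (measurable_stationaryPhase J hq hQ) ψ)) := by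
  let κ : ℝ := ((2 * Real.pi) ^ Module.finrank ℝ E)⁻¹
  have hκ : κ * (2 * Real.pi) ^ Module.finrank ℝ E = 1 := inv_mul_cancel₀ (by positivity)
  obtain ⟨C, hC⟩ := exists_norm_oscIntegral_le J χ
  refine tendsto_Lp_of_dominated ENNReal.ofNat_ne_top
    (f := fun ε b => κ • oscIntegral J χ ε (q b) (Q b) * ψ b) ?_ (coeFn_phaseMul _ ψ)
    ((Lp.memLp ψ).norm.const_mul (κ * C + 1)) ?_ (Eventually.of_forall fun b => ?_)
  · filter_upwards [self_mem_nhdsWithin] with ε hε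
    filter_upwards [coeFn_integral_oscWeight_smul_phaseMul J χ hε hq hQ ψ, Lp.coeFn_smul κ
      (∫ z, oscWeight J χ ε z • phaseMul (measurable_oscPhase J hq hQ z) ψ)] with b hint hsmul
    rw [hsmul, Pi.smul_apply, hint, smul_mul_assoc]
  · filter_upwards [self_mem_nhdsWithin] with ε hε
    refine Eventually.of_forall fun b => ?_
    rw [← sub_mul, norm_mul]
    gcongr
    refine (norm_sub_le _ _).trans ?_
    rw [Complex.norm_exp_ofReal_mul_I, norm_smul, Real.norm_of_nonneg (by positivity)]
    gcongr
    exact hC ε hε _ _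
  · have h := ((tendsto_oscIntegral J χ (q b) (Q b)).const_smul κ).mul_const (ψ b)
    have hlim : κ • ((2 * Real.pi) ^ Module.finrank ℝ E * χ (0, 0) *
        Complex.exp ((⟪J (Q b), q b⟫_ℝ : ℝ) * Complex.I))
          = Complex.exp ((⟪J (Q b), q b⟫_ℝ : ℝ) * Complex.I) := by
      rw [hχ, mul_one, Complex.real_smul, ← mul_assoc]
      exact_mod_cast congrArg (fun r : ℝ => (r : ℂ) * _) hκ |>.trans (one_mul _)
    rwa [hlim] at h

end OscillatoryPhase

/-! ### Creation and annihilation on the sectors -/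

section FockAlgebra

variable {α : Type*} [MeasurableSpace α] {μ : Measure α} [SigmaFinite μ] {k : ℕ}

lemma clm_ext_symVec {G : Type*} [NormedAddCommGroup G] [NormedSpace ℂ G]
    {A B : Sector μ k →L[ℂ] G} (h : ∀ f : Fin k → OneParticle μ, A (symVec f) = B (symVec f)) :
    A = B := by
  have hcombi : (A : Sector μ k →ₗ[ℂ] G) ∘ₗ combi μ k = (B : Sector μ k →ₗ[ℂ] G) ∘ₗ combi μ k := by
    ext f
    simpa [combi] using h f
  exact DFunLike.coe_injective ((denseRange_combi k).equalizer A.continuous B.continuous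
    (funext fun c => LinearMap.congr_fun hcombi c))

lemma sector_ext_inner {Ψ Φ : Sector μ k}
    (h : ∀ f : Fin k → OneParticle μ, ⟪Ψ, symVec f⟫_ℂ = ⟪Φ, symVec f⟫_ℂ) : Ψ = Φ := by
  have hinner : innerSL ℂ Ψ = innerSL ℂ Φ := clm_ext_symVec fun f => by simpa using h f
  exact ext_inner_right ℂ fun v => by simpa using DFunLike.congr_fun hinner v

lemma inner_tensorProd_symProd (f g : Fin k → OneParticle μ) :
    ⟪tensorProd f, symProd g⟫_ℂ =
      (k.factorial : ℂ)⁻¹ * (Matrix.of fun i j => ⟪f j, g i⟫_ℂ).permanent := by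
  simp only [symProd, inner_smul_right, inner_sum, inner_tensorProd, Matrix.permanent,
    Matrix.of_apply]

lemma inner_tensorProd_comp_perm_symProd (f g : Fin k → OneParticle μ)
    (σ : Equiv.Perm (Fin k)) :
    ⟪tensorProd fun i => f (σ i), symProd g⟫_ℂ = ⟪tensorProd f, symProd g⟫_ℂ := by
  rw [inner_tensorProd_symProd, inner_tensorProd_symProd,
    ← Matrix.permanent_permute_rows σ (Matrix.of fun i j => ⟪f j, g i⟫_ℂ)]
  rfl

lemma inner_smul_sum_perm_left {H : Type*} [NormedAddCommGroup H] [InnerProductSpace ℂ H]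
    {F : Equiv.Perm (Fin k) → H} {x : H} {c : ℂ} (h : ∀ σ, ⟪F σ, x⟫_ℂ = c) :
    ⟪(k.factorial : ℂ)⁻¹ • ∑ σ, F σ, x⟫_ℂ = c := by
  have hk : (k.factorial : ℂ) ≠ 0 := by exact_mod_cast k.factorial_ne_zero
  simp only [inner_smul_left, sum_inner, h, Finset.sum_const, Finset.card_univ,
    Fintype.card_perm, Fintype.card_fin, nsmul_eq_mul, map_inv₀, map_natCast,
    inv_mul_cancel_left₀ hk]

lemma inner_symProd_symProd (f g : Fin k → OneParticle μ) :
    ⟪symProd f, symProd g⟫_ℂ = ⟪tensorProd f, symProd g⟫_ℂ :=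
  inner_smul_sum_perm_left fun σ => inner_tensorProd_comp_perm_symProd f g σ

lemma coeFn_tensorProd (f : Fin k → OneParticle μ) :
    tensorProd f =ᵐ[piMeasure μ k] fun p => ∏ i, f i (p i) :=
  (memLp_prod f).coeFn_toLp

lemma coeFn_tensorCons (h : OneParticle μ) (Ψ : WaveFunction μ k) :
    tensorCons h Ψ =ᵐ[piMeasure μ (k + 1)] fun p => h (p 0) * Ψ (Fin.tail p) :=
  (memLp_cons h Ψ).coeFn_toLp

@[simp] lemma tensorConsL_apply (h : OneParticle μ) (Ψ : WaveFunction μ k) :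
    tensorConsL h k Ψ = tensorCons h Ψ := rfl

lemma tensorCons_tensorProd (h : OneParticle μ) (f : Fin k → OneParticle μ) :
    tensorCons h (tensorProd f) = tensorProd (Fin.cons h f : Fin (k + 1) → OneParticle μ) := by
  apply Lp.ext
  filter_upwards [coeFn_tensorCons h (tensorProd f),
    coeFn_tensorProd (Fin.cons h f : Fin (k + 1) → OneParticle μ),
    ae_tail (coeFn_tensorProd f)] with p hcons hprod htail
  rw [hcons, hprod, htail, Fin.prod_univ_succ]
  rfl

lemma inner_tensorCons_symProd (h : OneParticle μ) (f : Fin k → OneParticle μ)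
    (g : Fin (k + 1) → OneParticle μ) :
    ⟪tensorCons h (symProd f), symProd g⟫_ℂ
      = ⟪symProd (Fin.cons h f : Fin (k + 1) → OneParticle μ), symProd g⟫_ℂ := by
  rw [inner_symProd_symProd, ← tensorConsL_apply, symProd, map_smul, map_sum]
  refine inner_smul_sum_perm_left fun σ => ?_
  rw [tensorConsL_apply, tensorCons_tensorProd,
    ← inner_tensorProd_comp_perm_symProd (Fin.cons h f : Fin (k + 1) → OneParticle μ) g
      (Equiv.Perm.decomposeFin.symm (0, σ))]
  congr 2
  funext i
  cases i using Fin.cases <;> simp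

lemma sectorCreate_symVec (h : OneParticle μ) (f : Fin k → OneParticle μ) :
    sectorCreate h k (symVec f) = ((Real.sqrt ((k : ℝ) + 1) : ℝ) : ℂ) •
      symVec (Fin.cons h f : Fin (k + 1) → OneParticle μ) := by
  refine congrArg (((Real.sqrt ((k : ℝ) + 1) : ℝ) : ℂ) • ·) (sector_ext_inner fun g => ?_)
  simp only [ContinuousLinearMap.coe_coe, ContinuousLinearMap.comp_apply,
    Submodule.inner_orthogonalProjectionOnto_eq_of_mem_right]
  exact inner_tensorCons_symProd h f g

lemma sectorGamma_sectorCreate (W : OneParticle μ →ₗᵢ[ℂ] OneParticle μ) (h : OneParticle μ)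
    (Ψ : Sector μ k) :
    sectorGamma W (k + 1) (sectorCreate h k Ψ) = sectorCreate (W h) k (sectorGamma W k Ψ) := by
  suffices hcomp : (sectorGamma W (k + 1)).comp (sectorCreate h k)
      = (sectorCreate (W h) k).comp (sectorGamma W k) from DFunLike.congr_fun hcomp Ψ
  refine clm_ext_symVec fun f => ?_
  simp only [ContinuousLinearMap.comp_apply, sectorCreate_symVec, map_smul, sectorGamma_symVec]
  congr 2
  funext i
  cases i using Fin.cases <;> simp

lemma sectorGamma_symm_apply (W : OneParticle μ ≃ₗᵢ[ℂ] OneParticle μ) (Ψ : Sector μ k) :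
    sectorGamma W.symm.toLinearIsometry k (sectorGamma W.toLinearIsometry k Ψ) = Ψ := by
  suffices hcomp : (sectorGamma W.symm.toLinearIsometry k).comp
      (sectorGamma W.toLinearIsometry k) = ContinuousLinearMap.id ℂ (Sector μ k) from
    DFunLike.congr_fun hcomp Ψ
  refine clm_ext_symVec fun f => ?_
  simp only [ContinuousLinearMap.comp_apply, sectorGamma_symVec,
    LinearIsometryEquiv.coe_toLinearIsometry, LinearIsometryEquiv.symm_apply_apply,
    ContinuousLinearMap.id_apply]

/-- `Γ(W)` on the `k`-particle sector, as a unitary operator. -/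
def sectorGammaEquiv (W : OneParticle μ ≃ₗᵢ[ℂ] OneParticle μ) (k : ℕ) :
    Sector μ k ≃ₗᵢ[ℂ] Sector μ k where
  toFun := sectorGamma W.toLinearIsometry k
  map_add' := map_add _
  map_smul' := map_smul _
  invFun := sectorGamma W.symm.toLinearIsometry k
  left_inv := sectorGamma_symm_apply W
  right_inv := sectorGamma_symm_apply W.symm
  norm_map' := norm_sectorGamma W.toLinearIsometry k

lemma inner_sectorGamma_left (W : OneParticle μ ≃ₗᵢ[ℂ] OneParticle μ) (Ψ Φ : Sector μ k) :
    ⟪sectorGamma W.toLinearIsometry k Ψ, Φ⟫_ℂ = ⟪Ψ, sectorGamma W.symm.toLinearIsometry k Φ⟫_ℂ :=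
  (sectorGammaEquiv W k).inner_map_eq_flip Ψ Φ

lemma sectorGamma_adjoint_sectorCreate (W : OneParticle μ ≃ₗᵢ[ℂ] OneParticle μ)
    (h : OneParticle μ) (Ψ : Sector μ (k + 1)) :
    sectorGamma W.toLinearIsometry k ((sectorCreate h k).adjoint Ψ)
      = (sectorCreate (W h) k).adjoint (sectorGamma W.toLinearIsometry (k + 1) Ψ) := by
  refine ext_inner_right ℂ fun Φ => ?_
  rw [inner_sectorGamma_left, ContinuousLinearMap.adjoint_inner_left,
    ContinuousLinearMap.adjoint_inner_left, inner_sectorGamma_left, sectorGamma_sectorCreate,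
    LinearIsometryEquiv.coe_toLinearIsometry, LinearIsometryEquiv.symm_apply_apply]

end FockAlgebra

section PhaseCreate

variable {α : Type*} [MeasurableSpace α] {μ : Measure α} [SigmaFinite μ] {k : ℕ}

variable (μ) in
/-- `√(k+1) P_{k+1}` on the `(k+1)`-particle wave functions, so that
`a*(h) Ψ = createProj (h ⊗ Ψ)`. -/
def createProj (k : ℕ) : WaveFunction μ (k + 1) →L[ℂ] Sector μ (k + 1) :=
  ((Real.sqrt ((k : ℝ) + 1) : ℝ) : ℂ) • (symSubspace μ (k + 1)).orthogonalProjectionOnto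

lemma norm_createProj_le (k : ℕ) (Ψ : WaveFunction μ (k + 1)) :
    ‖createProj μ k Ψ‖ ≤ Real.sqrt ((k : ℝ) + 1) * ‖Ψ‖ := by
  rw [createProj, smul_apply, norm_smul, Complex.norm_real,
    Real.norm_of_nonneg (Real.sqrt_nonneg _)]
  gcongr
  exact Submodule.norm_orthogonalProjectionOnto_apply_le _ _

/-- `√(k+1) ⟨h|`, with `⟨h|` the contraction of the first variable with `h`, on the
`(k+1)`-particle wave functions. On symmetric wave functions this is `a(h)`. -/
def annihilateProj (h : OneParticle μ) (k : ℕ) : WaveFunction μ (k + 1) →L[ℂ] Sector μ k :=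
  ((Real.sqrt ((k : ℝ) + 1) : ℝ) : ℂ) •
    ((tensorConsL h k).comp (symSubspace μ k).subtypeL).adjoint

/-- The twisted creation operator `Ψ ↦ √(k+1) P_{k+1} (e^{i s} (h ⊗ Ψ))`, where the phase `s` may
depend on all `k + 1` variables. -/
def phaseCreate {s : (Fin (k + 1) → α) → ℝ} (hs : Measurable s) (h : OneParticle μ) :
    Sector μ k →L[ℂ] Sector μ (k + 1) :=
  (createProj μ k).comp ((phaseMul hs).toContinuousLinearMap.comp
    ((tensorConsL h k).comp (symSubspace μ k).subtypeL))

variable {s : (Fin (k + 1) → α) → ℝ}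

lemma phaseCreate_apply (hs : Measurable s) (h : OneParticle μ) (Ψ : Sector μ k) :
    phaseCreate hs h Ψ = createProj μ k (phaseMul hs (tensorCons h (Ψ : WaveFunction μ k))) := rfl

lemma norm_phaseCreate_le (hs : Measurable s) (h : OneParticle μ) :
    ‖phaseCreate hs h‖ ≤ ‖h‖ * Real.sqrt ((k : ℝ) + 1) := by
  refine ContinuousLinearMap.opNorm_le_bound _ (by positivity) fun Ψ => ?_
  rw [phaseCreate_apply]
  refine (norm_createProj_le k _).trans_eq ?_
  rw [LinearIsometry.norm_map, norm_tensorCons, Submodule.coe_norm]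
  ring

lemma adjoint_phaseCreate_apply (hs : Measurable s) (h : OneParticle μ) (Ψ : Sector μ (k + 1)) :
    (phaseCreate hs h).adjoint Ψ = annihilateProj h k (phaseMul hs.neg Ψ) := by
  refine ext_inner_right ℂ fun Φ => ?_
  rw [ContinuousLinearMap.adjoint_inner_left, phaseCreate_apply, createProj, annihilateProj,
    smul_apply, smul_apply, inner_smul_left, inner_smul_right, Complex.conj_ofReal,
    ContinuousLinearMap.adjoint_inner_left,
    Submodule.inner_orthogonalProjectionOnto_eq_of_mem_left]
  exact congrArg _ (inner_phaseMul_neg_left _ _ _).symm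

lemma tensorCons_phaseMul {a : α → ℝ} (ha : Measurable a) {b : (Fin k → α) → ℝ}
    (hb : Measurable b) (hs : Measurable s) (hsab : ∀ p, s p = a (p 0) + b (Fin.tail p))
    (h : OneParticle μ) (Ψ : WaveFunction μ k) :
    tensorCons (phaseMul ha h) (phaseMul hb Ψ) = phaseMul hs (tensorCons h Ψ) := by
  apply Lp.ext
  filter_upwards [coeFn_tensorCons (phaseMul ha h) (phaseMul hb Ψ),
    (Measure.quasiMeasurePreserving_eval (fun _ : Fin (k + 1) => μ) 0).ae (coeFn_phaseMul ha h),
    ae_tail (coeFn_phaseMul hb Ψ), coeFn_phaseMul hs (tensorCons h Ψ), coeFn_tensorCons h Ψ]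
    with p h_left h_head h_tail h_right h_cons
  rw [h_left, h_tail, h_right, h_cons, hsab, Complex.ofReal_add, add_mul, Complex.exp_add]
  simp only [Function.eval] at h_head
  rw [h_head]
  ring

lemma measurable_sum_eval {a : α → ℝ} (ha : Measurable a) (k : ℕ) :
    Measurable fun p : Fin k → α => ∑ i, a (p i) := by fun_prop

lemma tensorProd_phaseMul {a : α → ℝ} (ha : Measurable a) (f : Fin k → OneParticle μ) :
    tensorProd (fun i => phaseMul ha (f i))
      = phaseMul (measurable_sum_eval ha k) (tensorProd f) := by
  apply Lp.ext
  have h_factor : ∀ᵐ p ∂piMeasure μ k, ∀ i,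
      phaseMul ha (f i) (p i) = Complex.exp (a (p i) * Complex.I) * f i (p i) :=
    ae_all_iff.2 fun i => (Measure.quasiMeasurePreserving_eval (fun _ : Fin k => μ) i).ae
      (coeFn_phaseMul ha (f i))
  filter_upwards [coeFn_tensorProd fun i => phaseMul ha (f i), coeFn_tensorProd f, h_factor,
    coeFn_phaseMul (measurable_sum_eval ha k) (tensorProd f)] with p h_left h_prod h_factor h_right
  rw [h_left, h_right, h_prod, Finset.prod_congr rfl fun i _ => h_factor i,
    Finset.prod_mul_distrib, ← Complex.exp_sum, Complex.ofReal_sum, Finset.sum_mul]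

lemma coe_sectorGamma_phaseMul {a : α → ℝ} (ha : Measurable a) (Ψ : Sector μ k) :
    (sectorGamma (phaseMul ha) k Ψ : WaveFunction μ k)
      = phaseMul (measurable_sum_eval ha k) (Ψ : WaveFunction μ k) := by
  suffices hcomp : (symSubspace μ k).subtypeL.comp (sectorGamma (phaseMul ha) k)
      = (phaseMul (measurable_sum_eval ha k)).toContinuousLinearMap.comp
        (symSubspace μ k).subtypeL from DFunLike.congr_fun hcomp Ψ
  refine clm_ext_symVec fun f => ?_
  simp only [ContinuousLinearMap.comp_apply, sectorGamma_symVec]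
  simp only [Submodule.subtypeL_apply, symVec, LinearIsometry.coe_toContinuousLinearMap, symProd,
    map_smul, map_sum]
  exact congrArg _ (Finset.sum_congr rfl fun σ _ => tensorProd_phaseMul ha fun i => f (σ i))

lemma sectorCreate_phaseMul_sectorGamma_phaseMul {a b : α → ℝ} (ha : Measurable a)
    (hb : Measurable b) (hs : Measurable s)
    (hsab : ∀ p, s p = a (p 0) + ∑ i, b (Fin.tail p i)) (h : OneParticle μ) (Ψ : Sector μ k) :
    sectorCreate (phaseMul ha h) k (sectorGamma (phaseMul hb) k Ψ) = phaseCreate hs h Ψ := by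
  rw [phaseCreate_apply, ← tensorCons_phaseMul ha (measurable_sum_eval hb k) hs hsab,
    ← coe_sectorGamma_phaseMul]
  rfl

lemma sectorCreate_phaseMul {a : α → ℝ} (ha : Measurable a) (h : OneParticle μ) (k : ℕ) :
    sectorCreate (phaseMul ha h) k
      = phaseCreate (ha.comp (measurable_pi_apply (0 : Fin (k + 1)))) h := by
  ext1 Ψ
  rw [phaseCreate_apply, ← tensorCons_phaseMul ha (b := fun _ => 0) measurable_const _
    (fun p => (add_zero _).symm), phaseMul_zero]
  rfl

lemma adjoint_sectorCreate_phaseMul_sectorGamma_phaseMul {a b : α → ℝ} (ha : Measurable a)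
    (hb : Measurable b) (hs : Measurable s)
    (hsab : ∀ p, s p = -a (p 0) + ∑ i, b (p i)) (h : OneParticle μ) (Ψ : Sector μ (k + 1)) :
    (sectorCreate (phaseMul ha h) k).adjoint (sectorGamma (phaseMul hb) (k + 1) Ψ)
      = annihilateProj h k (phaseMul hs Ψ) := by
  rw [sectorCreate_phaseMul, adjoint_phaseCreate_apply, coe_sectorGamma_phaseMul,
    phaseMul_phaseMul]
  exact congrArg _ (phaseMul_congr _ _ (fun p => (hsab p).symm) _)

end PhaseCreate

/-! ### Operators on finite particle vectors -/

section FiniteParticle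

variable {α : Type*} [MeasurableSpace α] {μ : Measure α} [SigmaFinite μ] {k : ℕ}

lemma inclSector_apply_self (Ψ : Sector μ k) : (inclSector μ k Ψ : Fock μ) k = Ψ :=
  lp.single_apply_self (E := fun k : ℕ => Sector μ k) 2 k Ψ

lemma inclSector_apply_ne {j : ℕ} (Ψ : Sector μ k) (h : j ≠ k) :
    (inclSector μ k Ψ : Fock μ) j = 0 :=
  lp.single_apply_ne (E := fun k : ℕ => Sector μ k) 2 k Ψ h

lemma diagOp_inclSector (A : (k : ℕ) → Sector μ k →ₗ[ℂ] Sector μ k) (Ψ : Sector μ k) :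
    diagOp A (inclSector μ k Ψ) = inclSector μ k (A k Ψ) := by
  refine finiteParticle_ext fun j => ?_
  change A j ((inclSector μ k Ψ : Fock μ) j) = _
  rcases eq_or_ne j k with rfl | h
  · rw [inclSector_apply_self, inclSector_apply_self]
  · rw [inclSector_apply_ne _ h, inclSector_apply_ne _ h, map_zero]

lemma secondQuant_inclSector (W : OneParticle μ ≃ₗᵢ[ℂ] OneParticle μ) (Ψ : Sector μ k) :
    secondQuant W (inclSector μ k Ψ) = inclSector μ k (sectorGamma W.toLinearIsometry k Ψ) :=
  diagOp_inclSector _ Ψ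

lemma raiseOp_inclSector (A : (k : ℕ) → Sector μ k →ₗ[ℂ] Sector μ (k + 1)) (Ψ : Sector μ k) :
    raiseOp A (inclSector μ k Ψ) = inclSector μ (k + 1) (A k Ψ) := by
  refine finiteParticle_ext fun j => ?_
  cases j with
  | zero => exact (inclSector_apply_ne _ (Nat.succ_ne_zero k).symm).symm
  | succ j =>
    change A j ((inclSector μ k Ψ : Fock μ) j) = _
    rcases eq_or_ne j k with rfl | h
    · rw [inclSector_apply_self, inclSector_apply_self]
    · rw [inclSector_apply_ne _ h, inclSector_apply_ne _ (by omega), map_zero]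

lemma lowerOp_inclSector_succ (A : (k : ℕ) → Sector μ (k + 1) →ₗ[ℂ] Sector μ k)
    (Ψ : Sector μ (k + 1)) : lowerOp A (inclSector μ (k + 1) Ψ) = inclSector μ k (A k Ψ) := by
  refine finiteParticle_ext fun j => ?_
  change A j ((inclSector μ (k + 1) Ψ : Fock μ) (j + 1)) = _
  rcases eq_or_ne j k with rfl | h
  · rw [inclSector_apply_self, inclSector_apply_self]
  · rw [inclSector_apply_ne _ h, inclSector_apply_ne _ (by omega), map_zero]

lemma lowerOp_inclSector_zero (A : (k : ℕ) → Sector μ (k + 1) →ₗ[ℂ] Sector μ k)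
    (Ψ : Sector μ 0) : lowerOp A (inclSector μ 0 Ψ) = 0 := by
  refine finiteParticle_ext fun j => ?_
  change A j ((inclSector μ 0 Ψ : Fock μ) (j + 1)) = 0
  rw [inclSector_apply_ne _ (Nat.succ_ne_zero j), map_zero]

lemma coe_sum_apply {ι : Type*} (s : Finset ι) (F : ι → finiteParticle μ) (j : ℕ) :
    ((∑ i ∈ s, F i : finiteParticle μ) : Fock μ) j = ∑ i ∈ s, (F i : Fock μ) j := by
  rw [Submodule.coe_sum, lp.coeFn_sum, Finset.sum_apply]

lemma exists_eq_sum_inclSector (Ψ : finiteParticle μ) :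
    ∃ K : ℕ, Ψ = ∑ k ∈ Finset.range K, inclSector μ k ((Ψ : Fock μ) k) := by
  obtain ⟨K, hK⟩ := Ψ.2
  refine ⟨K, finiteParticle_ext fun j => ?_⟩
  rw [coe_sum_apply]
  by_cases hj : j < K
  · rw [Finset.sum_eq_single_of_mem j (Finset.mem_range.2 hj)
      fun i _ hi => inclSector_apply_ne _ hi.symm, inclSector_apply_self]
  · rw [hK j (not_lt.1 hj), Finset.sum_eq_zero fun i hi =>
      inclSector_apply_ne _ (by rw [Finset.mem_range] at hi; omega)]

lemma finiteParticle_induction {motive : finiteParticle μ → Prop} (zero : motive 0)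
    (add : ∀ Ψ Φ, motive Ψ → motive Φ → motive (Ψ + Φ))
    (inclSector : ∀ k Ψ, motive (inclSector μ k Ψ)) (Ψ : finiteParticle μ) : motive Ψ := by
  obtain ⟨K, hK⟩ := exists_eq_sum_inclSector Ψ
  rw [hK]
  exact Finset.sum_induction _ motive add zero fun k _ => inclSector k _

lemma secondQuant_create (W : OneParticle μ ≃ₗᵢ[ℂ] OneParticle μ) (h : OneParticle μ)
    (Ψ : finiteParticle μ) :
    secondQuant W (create h Ψ) = create (W h) (secondQuant W Ψ) := by
  refine finiteParticle_ext fun k => ?_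
  cases k with
  | zero => exact map_zero (sectorGamma W.toLinearIsometry 0)
  | succ k => exact sectorGamma_sectorCreate W.toLinearIsometry h _

lemma secondQuant_annihilate (W : OneParticle μ ≃ₗᵢ[ℂ] OneParticle μ) (h : OneParticle μ)
    (Ψ : finiteParticle μ) :
    secondQuant W (annihilate h Ψ) = annihilate (W h) (secondQuant W Ψ) :=
  finiteParticle_ext fun _ => sectorGamma_adjoint_sectorCreate W h _

lemma secondQuant_symm_secondQuant (W : OneParticle μ ≃ₗᵢ[ℂ] OneParticle μ)
    (Ψ : finiteParticle μ) : secondQuant W.symm (secondQuant W Ψ) = Ψ :=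
  finiteParticle_ext fun _ => sectorGamma_symm_apply W _

lemma hasSum_norm_sq (Ψ : finiteParticle μ) :
    HasSum (fun k => ‖(Ψ : Fock μ) k‖ ^ 2) (‖Ψ‖ ^ 2) := by
  simpa using lp.hasSum_norm (p := 2) (by norm_num) (Ψ : Fock μ)

lemma norm_secondQuant (W : OneParticle μ ≃ₗᵢ[ℂ] OneParticle μ) (Ψ : finiteParticle μ) :
    ‖secondQuant W Ψ‖ = ‖Ψ‖ := by
  have hsum := hasSum_norm_sq (secondQuant W Ψ)
  simp only [show ∀ k, ‖(secondQuant W Ψ : Fock μ) k‖ = ‖(Ψ : Fock μ) k‖ from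
    fun k => norm_sectorGamma W.toLinearIsometry k _] at hsum
  exact (pow_left_inj₀ (norm_nonneg _) (norm_nonneg _) two_ne_zero).1
    (hsum.unique (hasSum_norm_sq Ψ))

lemma sqrtNumberAddOne_secondQuant (W : OneParticle μ ≃ₗᵢ[ℂ] OneParticle μ)
    (Ψ : finiteParticle μ) :
    sqrtNumberAddOne μ (secondQuant W Ψ) = secondQuant W (sqrtNumberAddOne μ Ψ) :=
  finiteParticle_ext fun k => (map_smul (sectorGamma W.toLinearIsometry k)
    ((Real.sqrt ((k : ℝ) + 1) : ℝ) : ℂ) ((Ψ : Fock μ) k)).symm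

lemma norm_sqrtNumberAddOne_secondQuant (W : OneParticle μ ≃ₗᵢ[ℂ] OneParticle μ)
    (Ψ : finiteParticle μ) : ‖sqrtNumberAddOne μ (secondQuant W Ψ)‖ = ‖sqrtNumberAddOne μ Ψ‖ := by
  rw [sqrtNumberAddOne_secondQuant, norm_secondQuant]

lemma norm_sqrtNumberAddOne_apply (Ψ : finiteParticle μ) (k : ℕ) :
    ‖(sqrtNumberAddOne μ Ψ : Fock μ) k‖ = Real.sqrt ((k : ℝ) + 1) * ‖(Ψ : Fock μ) k‖ := by
  change ‖((Real.sqrt ((k : ℝ) + 1) : ℝ) : ℂ) • (Ψ : Fock μ) k‖ = _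
  rw [norm_smul, Complex.norm_real, Real.norm_of_nonneg (Real.sqrt_nonneg _)]

lemma norm_raiseOp_le {A : (k : ℕ) → Sector μ k →ₗ[ℂ] Sector μ (k + 1)} {C : ℝ} (hC : 0 ≤ C)
    (hA : ∀ k Ψ, ‖A k Ψ‖ ≤ C * Real.sqrt ((k : ℝ) + 1) * ‖Ψ‖) (Ψ : finiteParticle μ) :
    ‖raiseOp A Ψ‖ ≤ C * ‖sqrtNumberAddOne μ Ψ‖ := by
  refine le_of_sq_le_sq ?_ (by positivity)
  have hsum := (hasSum_nat_add_iff' 1).2 (hasSum_norm_sq (raiseOp A Ψ))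
  have h_vacuum : (raiseOp A Ψ : Fock μ) 0 = 0 := rfl
  rw [Finset.sum_range_one, h_vacuum, norm_zero, zero_pow two_ne_zero, sub_zero] at hsum
  rw [mul_pow]
  refine hasSum_le (fun k => ?_) hsum ((hasSum_norm_sq (sqrtNumberAddOne μ Ψ)).mul_left (C ^ 2))
  rw [← mul_pow, norm_sqrtNumberAddOne_apply, ← mul_assoc]
  exact pow_le_pow_left₀ (norm_nonneg _) (hA k _) 2

lemma norm_lowerOp_le {A : (k : ℕ) → Sector μ (k + 1) →ₗ[ℂ] Sector μ k} {C : ℝ} (hC : 0 ≤ C)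
    (hA : ∀ k Ψ, ‖A k Ψ‖ ≤ C * Real.sqrt ((k : ℝ) + 1) * ‖Ψ‖) (Ψ : finiteParticle μ) :
    ‖lowerOp A Ψ‖ ≤ C * ‖sqrtNumberAddOne μ Ψ‖ := by
  refine le_of_sq_le_sq ?_ (by positivity)
  have hsum := (hasSum_nat_add_iff' 1).2 (hasSum_norm_sq (sqrtNumberAddOne μ Ψ))
  have h_term : ∀ k, ‖(lowerOp A Ψ : Fock μ) k‖ ^ 2
      ≤ C ^ 2 * ‖(sqrtNumberAddOne μ Ψ : Fock μ) (k + 1)‖ ^ 2 := fun k => by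
    rw [← mul_pow, norm_sqrtNumberAddOne_apply, ← mul_assoc]
    refine pow_le_pow_left₀ (norm_nonneg _) ((hA k _).trans ?_) 2
    push_cast
    gcongr
    linarith
  refine (hasSum_le h_term (hasSum_norm_sq (lowerOp A Ψ)) (hsum.mul_left (C ^ 2))).trans ?_
  rw [mul_pow, Finset.sum_range_one]
  gcongr
  exact sub_le_self _ (sq_nonneg _)

end FiniteParticle

/-! ### Phases on the mass shell -/

section MassShell

variable {n : ℕ} {m : ℝ} {θ : Matrix (Fin (n + 1)) (Fin (n + 1)) ℝ} {k : ℕ}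

/-- The reflection of the spatial coordinates, the isometry representing the Lorentzian scalar
product with respect to the Euclidean one. -/
def spaceReflect (n : ℕ) : SpaceTime n ≃ₗᵢ[ℝ] SpaceTime n :=
  LinearIsometryEquiv.piLpCongrRight 2 fun i : Fin (n + 1) =>
    if i = 0 then LinearIsometryEquiv.refl ℝ ℝ else LinearIsometryEquiv.neg ℝ

lemma lorentz_eq_inner (x y : SpaceTime n) : lorentz x y = ⟪spaceReflect n x, y⟫_ℝ := by
  rw [PiLp.inner_apply, Fin.sum_univ_succ, lorentz]
  simp [spaceReflect, LinearIsometryEquiv.piLpCongrRight_apply, Fin.succ_ne_zero, mul_comm,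
    Finset.sum_neg_distrib, sub_eq_add_neg]

lemma lorentz_comm (x y : SpaceTime n) : lorentz x y = lorentz y x := by
  simp [lorentz, mul_comm]

lemma IsLorentzSkew.lorentz_self (hθ : IsLorentzSkew θ) (x : SpaceTime n) :
    lorentz x (Matrix.toEuclideanLin θ x) = 0 := by
  linarith [hθ x x, lorentz_comm (Matrix.toEuclideanLin θ x) x]

lemma measurable_onShell (m : ℝ) : Measurable (onShell m : Mom n → SpaceTime n) :=
  (continuous_onShell m).measurable

lemma measurable_lorentz_onShell (m : ℝ) (y : SpaceTime n) :
    Measurable fun p : Mom n => lorentz y (onShell m p) :=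
  (continuous_lorentz y).measurable.comp (measurable_onShell m)

lemma toLinearIsometry_translate1 (y : SpaceTime n) :
    (translate1 y : H1 n m ≃ₗᵢ[ℂ] H1 n m).toLinearIsometry
      = phaseMul (measurable_lorentz_onShell m y) := by
  refine LinearIsometry.ext fun ψ => Lp.ext ?_
  filter_upwards [(memLp_phase y ψ).coeFn_toLp,
    coeFn_phaseMul (measurable_lorentz_onShell m y) ψ] with p h_left h_right
  rw [h_right, mul_comm _ Complex.I]
  exact h_left

lemma translate1_apply (y : SpaceTime n) (ψ : H1 n m) :
    translate1 y ψ = phaseMul (measurable_lorentz_onShell m y) ψ :=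
  DFunLike.congr_fun (toLinearIsometry_translate1 y) ψ

lemma translate1_neg (y : SpaceTime n) :
    (translate1 (-y) : H1 n m ≃ₗᵢ[ℂ] H1 n m) = (translate1 y).symm := by
  ext1 ψ
  rfl

/-- The total energy-momentum of `k` particles of mass `m`. -/
def totalMomentum (m : ℝ) (p : Fin k → Mom n) : SpaceTime n := ∑ i, onShell m (p i)

lemma measurable_totalMomentum (m : ℝ) (k : ℕ) :
    Measurable (totalMomentum m : (Fin k → Mom n) → SpaceTime n) :=
  Finset.measurable_sum _ fun i _ => (measurable_onShell m).comp (measurable_pi_apply i)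

lemma measurable_totalMomentum_tail (m : ℝ) (k : ℕ) :
    Measurable fun p : Fin (k + 1) → Mom n => totalMomentum m (Fin.tail p) :=
  (measurable_totalMomentum m k).comp (measurable_pi_lambda _ fun _ => measurable_pi_apply _)

lemma totalMomentum_succ (m : ℝ) (p : Fin (k + 1) → Mom n) :
    totalMomentum m p = onShell m (p 0) + totalMomentum m (Fin.tail p) :=
  Fin.sum_univ_succ _

lemma inner_spaceReflect_totalMomentum (m : ℝ) (p : Fin k → Mom n) (y : SpaceTime n) :
    ⟪spaceReflect n (totalMomentum m p), y⟫_ℝ = ∑ i, lorentz y (onShell m (p i)) := by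
  simp only [totalMomentum, map_sum, sum_inner, lorentz_comm y, lorentz_eq_inner]

/-- The vector `θ p₀`, where `p₀` is the energy-momentum of the first particle. -/
def leadMomentum (m : ℝ) (θ : Matrix (Fin (n + 1)) (Fin (n + 1)) ℝ) (p : Fin (k + 1) → Mom n) :
    SpaceTime n :=
  Matrix.toEuclideanLin θ (onShell m (p 0))

lemma measurable_leadMomentum (m : ℝ) (θ : Matrix (Fin (n + 1)) (Fin (n + 1)) ℝ) (k : ℕ) :
    Measurable (leadMomentum m θ : (Fin (k + 1) → Mom n) → SpaceTime n) :=
  (LinearMap.continuous_of_finiteDimensional (Matrix.toEuclideanLin θ)).measurable.comp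
    ((measurable_onShell m).comp (measurable_pi_apply 0))

lemma sectorCreate_translate1_sectorGamma_translate1 (hθ : IsLorentzSkew θ) (g : H1 n m)
    (Ψ : Sector (shellMeasure n m) k) (x y : SpaceTime n) :
    sectorCreate (translate1 (Matrix.toEuclideanLin θ x) g) k
        (sectorGamma (translate1 y).toLinearIsometry k Ψ)
      = phaseCreate (measurable_oscPhase (spaceReflect n) (measurable_leadMomentum m θ k).neg
          (measurable_totalMomentum_tail m k) (x, y)) g Ψ := by
  rw [toLinearIsometry_translate1, translate1_apply]
  refine sectorCreate_phaseMul_sectorGamma_phaseMul _ _ _ (fun p => ?_) g Ψ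
  rw [oscPhase, inner_spaceReflect_totalMomentum, hθ, Pi.neg_apply, inner_neg_right,
    lorentz_eq_inner]
  rfl

lemma adjoint_sectorCreate_translate1_sectorGamma_translate1 (hθ : IsLorentzSkew θ) (g : H1 n m)
    (Ψ : Sector (shellMeasure n m) (k + 1)) (x y : SpaceTime n) :
    (sectorCreate (translate1 (Matrix.toEuclideanLin θ x) g) k).adjoint
        (sectorGamma (translate1 y).toLinearIsometry (k + 1) Ψ)
      = annihilateProj g k (phaseMul (measurable_oscPhase (spaceReflect n)
          (measurable_leadMomentum m θ k) (measurable_totalMomentum m (k + 1)) (x, y)) Ψ) := by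
  rw [toLinearIsometry_translate1, translate1_apply]
  refine adjoint_sectorCreate_phaseMul_sectorGamma_phaseMul _ _ _ (fun p => ?_) g Ψ
  rw [oscPhase, inner_spaceReflect_totalMomentum, hθ, neg_neg, lorentz_eq_inner]
  rfl

end MassShell

/-! ### The deformed operators -/

section Warp

variable {n : ℕ} {m : ℝ} {θ : Matrix (Fin (n + 1)) (Fin (n + 1)) ℝ} {V : H1 n m ≃ₗᵢ[ℂ] H1 n m}
  {A B C : finiteParticle (shellMeasure n m) →ₗ[ℂ] finiteParticle (shellMeasure n m)}
  {Φ Φ₁ Φ₂ : finiteParticle (shellMeasure n m)} {Ξ₁ Ξ₂ : Fock (shellMeasure n m)} {k : ℕ}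

lemma IsWarped.add_of_forall_eq_add
    (h : ∀ x y, adjointX V x C (groupX V y Φ)
      = adjointX V x A (groupX V y Φ₁) + adjointX V x B (groupX V y Φ₂))
    (h₁ : IsWarped θ V A Φ₁ Ξ₁) (h₂ : IsWarped θ V B Φ₂ Ξ₂) :
    IsWarped θ V C Φ (Ξ₁ + Ξ₂) := by
  intro χ hχ
  obtain ⟨h_int₁, h_lim₁⟩ := h₁ χ hχ
  obtain ⟨h_int₂, h_lim₂⟩ := h₂ χ hχ
  have h_add (ε : ℝ) : warpIntegrand θ V C Φ χ ε
      = warpIntegrand θ V A Φ₁ χ ε + warpIntegrand θ V B Φ₂ χ ε := by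
    ext1 z
    simp only [warpIntegrand, h, Pi.add_apply, Submodule.coe_add, smul_add]
  refine ⟨fun ε hε => h_add ε ▸ (h_int₁ ε hε).add (h_int₂ ε hε), ?_⟩
  refine (h_lim₁.add h_lim₂).congr' ?_
  filter_upwards [self_mem_nhdsWithin] with ε hε
  rw [h_add, integral_add' (h_int₁ ε hε) (h_int₂ ε hε), smul_add]

lemma IsWarped.add_vector (h₁ : IsWarped θ V A Φ₁ Ξ₁) (h₂ : IsWarped θ V A Φ₂ Ξ₂) :
    IsWarped θ V A (Φ₁ + Φ₂) (Ξ₁ + Ξ₂) :=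
  h₁.add_of_forall_eq_add (fun x y => by simp only [map_add]) h₂

lemma IsWarped.add_operator (h₁ : IsWarped θ V A Φ Ξ₁) (h₂ : IsWarped θ V B Φ Ξ₂) :
    IsWarped θ V (A + B) Φ (Ξ₁ + Ξ₂) :=
  h₁.add_of_forall_eq_add
    (fun x y => by simp only [adjointX, LinearMap.comp_apply, LinearMap.add_apply, map_add]) h₂

lemma isWarped_zero_of_forall_eq_zero (h : ∀ x y, adjointX V x A (groupX V y Φ) = 0) :
    IsWarped θ V A Φ 0 := by
  intro χ _
  have h_zero (ε : ℝ) : warpIntegrand θ V A Φ χ ε = 0 := by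
    ext1 z
    rw [warpIntegrand, h, ZeroMemClass.coe_zero, smul_zero, Pi.zero_apply]
  refine ⟨fun ε _ => h_zero ε ▸ integrable_zero _ _ _, ?_⟩
  simp only [h_zero, Pi.zero_apply, integral_zero, smul_zero]
  exact tendsto_const_nhds

lemma isWarped_of_forall_inclSector
    (h : ∀ k Ψ, IsWarped θ V A (inclSector _ k Ψ) (B (inclSector _ k Ψ) : Fock _))
    (Φ : finiteParticle (shellMeasure n m)) : IsWarped θ V A Φ (B Φ : Fock _) := by
  induction Φ using finiteParticle_induction with
  | zero =>
    rw [map_zero]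
    exact isWarped_zero_of_forall_eq_zero fun x y => by rw [map_zero, map_zero]
  | add Ψ Φ hΨ hΦ =>
    rw [map_add]
    exact hΨ.add_vector hΦ
  | inclSector k Ψ => exact h k Ψ

lemma isWarped_of_forall_eq_phaseMul {β : Type*} [MeasurableSpace β] {ν : Measure β} [SFinite ν]
    {q Q : β → SpaceTime n} (hq : Measurable q) (hQ : Measurable Q) (Ω : Lp ℂ 2 ν)
    (L : Lp ℂ 2 ν →L[ℂ] Fock (shellMeasure n m))
    (h : ∀ x y, (adjointX V (Matrix.toEuclideanLin θ x) A (groupX V y Φ) : Fock _)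
      = L (phaseMul (measurable_oscPhase (spaceReflect n) hq hQ (x, y)) Ω)) :
    IsWarped θ V A Φ (L (phaseMul (measurable_stationaryPhase (spaceReflect n) hq hQ) Ω)) := by
  intro χ hχ
  have h_eq (ε : ℝ) : warpIntegrand θ V A Φ χ ε = fun z => L (oscWeight (spaceReflect n) χ ε z •
      phaseMul (measurable_oscPhase (spaceReflect n) hq hQ z) Ω) := by
    ext1 z
    rw [warpIntegrand, h, L.map_smul, oscWeight, lorentz_eq_inner]
  have h_int {ε : ℝ} (hε : ε ≠ 0) :=
    integrable_oscWeight_smul_phaseMul (spaceReflect n) χ hε hq hQ Ω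
  refine ⟨fun ε hε => h_eq ε ▸ L.integrable_comp (h_int hε), ?_⟩
  have h_lim := tendsto_integral_oscWeight_smul_phaseMul (spaceReflect n) χ hχ hq hQ Ω
  rw [finrank_euclideanSpace_fin] at h_lim
  refine ((L.continuous.tendsto _).comp h_lim).congr' ?_
  filter_upwards [self_mem_nhdsWithin] with ε hε
  rw [h_eq, L.integral_comp_comm (h_int hε), Function.comp_apply]
  exact L.map_smul_of_tower _ _

lemma adjointX_create_groupX (h : H1 n m) (v y : SpaceTime n) :
    adjointX V v (create h) (groupX V y Φ) = secondQuant V.symm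
      (create (translate1 v (V h)) (secondQuant (translate1 y) (secondQuant V Φ))) := by
  have hV (Ψ : finiteParticle (shellMeasure n m)) := secondQuant_symm_secondQuant V.symm Ψ
  have hv (Ψ : finiteParticle (shellMeasure n m)) :=
    secondQuant_symm_secondQuant (translate1 v).symm Ψ
  simp only [LinearIsometryEquiv.symm_symm] at hV hv
  simp only [adjointX, groupX, LinearMap.comp_apply, hV, translate1_neg, secondQuant_create, hv]

lemma adjointX_annihilate_groupX (h : H1 n m) (v y : SpaceTime n) :
    adjointX V v (annihilate h) (groupX V y Φ) = secondQuant V.symm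
      (annihilate (translate1 v (V h)) (secondQuant (translate1 y) (secondQuant V Φ))) := by
  have hV (Ψ : finiteParticle (shellMeasure n m)) := secondQuant_symm_secondQuant V.symm Ψ
  have hv (Ψ : finiteParticle (shellMeasure n m)) :=
    secondQuant_symm_secondQuant (translate1 v).symm Ψ
  simp only [LinearIsometryEquiv.symm_symm] at hV hv
  simp only [adjointX, groupX, LinearMap.comp_apply, hV, translate1_neg, secondQuant_annihilate,
    hv]

/-- The deformed creation operator for `X = P` on the `k`-particle sector,
`Ψ ↦ √(k+1) P_{k+1} (e^{-i (p₁+⋯+p_k)·θp₀} g ⊗ Ψ)`. Its adjoint is the deformed annihilation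
operator. -/
def warpedSectorCreate (θ : Matrix (Fin (n + 1)) (Fin (n + 1)) ℝ) (g : H1 n m) (k : ℕ) :
    Sector (shellMeasure n m) k →L[ℂ] Sector (shellMeasure n m) (k + 1) :=
  phaseCreate (measurable_stationaryPhase (spaceReflect n) (measurable_leadMomentum m θ k).neg
    (measurable_totalMomentum_tail m k)) g

lemma norm_warpedSectorCreate_le (g : H1 n m) (k : ℕ) :
    ‖warpedSectorCreate θ g k‖ ≤ ‖g‖ * Real.sqrt ((k : ℝ) + 1) :=
  norm_phaseCreate_le _ g

lemma adjoint_warpedSectorCreate_apply (hθ : IsLorentzSkew θ) (g : H1 n m)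
    (Ψ : Sector (shellMeasure n m) (k + 1)) :
    (warpedSectorCreate θ g k).adjoint Ψ = annihilateProj g k
      (phaseMul (measurable_stationaryPhase (spaceReflect n) (measurable_leadMomentum m θ k)
        (measurable_totalMomentum m (k + 1))) Ψ) := by
  rw [warpedSectorCreate, adjoint_phaseCreate_apply]
  refine congrArg _ (phaseMul_congr _ _ (fun p => ?_) _)
  have h_self : ⟪spaceReflect n (onShell m (p 0)), leadMomentum m θ p⟫_ℝ = 0 := by
    rw [← lorentz_eq_inner]
    exact hθ.lorentz_self _
  rw [totalMomentum_succ, map_add, inner_add_left, h_self, zero_add]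
  simp only [Pi.neg_apply, inner_neg_right, neg_neg]

/-- The deformed creation operator `a*_{θ,X}(h)`. -/
def warpedCreate (θ : Matrix (Fin (n + 1)) (Fin (n + 1)) ℝ) (V : H1 n m ≃ₗᵢ[ℂ] H1 n m)
    (h : H1 n m) : finiteParticle (shellMeasure n m) →ₗ[ℂ] finiteParticle (shellMeasure n m) :=
  secondQuant V.symm ∘ₗ raiseOp (fun k => (warpedSectorCreate θ (V h) k).toLinearMap) ∘ₗ
    secondQuant V

/-- The deformed annihilation operator `a_{θ,X}(h)`. -/
def warpedAnnihilate (θ : Matrix (Fin (n + 1)) (Fin (n + 1)) ℝ) (V : H1 n m ≃ₗᵢ[ℂ] H1 n m)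
    (h : H1 n m) : finiteParticle (shellMeasure n m) →ₗ[ℂ] finiteParticle (shellMeasure n m) :=
  secondQuant V.symm ∘ₗ lowerOp (fun k => (warpedSectorCreate θ (V h) k).adjoint.toLinearMap) ∘ₗ
    secondQuant V

lemma norm_warpedCreate_le (h : H1 n m) (Ψ : finiteParticle (shellMeasure n m)) :
    ‖warpedCreate θ V h Ψ‖ ≤ ‖h‖ * ‖sqrtNumberAddOne (shellMeasure n m) Ψ‖ := by
  rw [warpedCreate, LinearMap.comp_apply, LinearMap.comp_apply, norm_secondQuant,
    ← norm_sqrtNumberAddOne_secondQuant V Ψ, ← V.norm_map h]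
  exact norm_raiseOp_le (norm_nonneg _) (fun k =>
    (warpedSectorCreate θ (V h) k).le_of_opNorm_le (norm_warpedSectorCreate_le _ k)) _

lemma norm_warpedAnnihilate_le (h : H1 n m) (Ψ : finiteParticle (shellMeasure n m)) :
    ‖warpedAnnihilate θ V h Ψ‖ ≤ ‖h‖ * ‖sqrtNumberAddOne (shellMeasure n m) Ψ‖ := by
  rw [warpedAnnihilate, LinearMap.comp_apply, LinearMap.comp_apply, norm_secondQuant,
    ← norm_sqrtNumberAddOne_secondQuant V Ψ, ← V.norm_map h]
  exact norm_lowerOp_le (norm_nonneg _) (fun k => ContinuousLinearMap.le_of_opNorm_le _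
    ((LinearIsometryEquiv.norm_map _ _).trans_le (norm_warpedSectorCreate_le _ k))) _

/-- `Γ(W)` on the `k`-particle sector, as a bounded operator into the Fock space. -/
def gammaIncl (W : H1 n m ≃ₗᵢ[ℂ] H1 n m) (k : ℕ) :
    Sector (shellMeasure n m) k →L[ℂ] Fock (shellMeasure n m) :=
  (lp.singleContinuousLinearMap ℂ (fun k : ℕ => Sector (shellMeasure n m) k) 2 k).comp
    (sectorGamma W.toLinearIsometry k)

lemma coe_secondQuant_inclSector (W : H1 n m ≃ₗᵢ[ℂ] H1 n m) (Ψ : Sector (shellMeasure n m) k) :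
    (secondQuant W (inclSector _ k Ψ) : Fock _) = gammaIncl W k Ψ := by
  rw [secondQuant_inclSector]
  rfl

lemma isWarped_create (hθ : IsLorentzSkew θ) (h : H1 n m)
    (Φ : finiteParticle (shellMeasure n m)) :
    IsWarped θ V (create h) Φ (warpedCreate θ V h Φ : Fock _) := by
  refine isWarped_of_forall_inclSector (fun k Ψ => ?_) Φ
  have h_limit : (warpedCreate θ V h (inclSector _ k Ψ) : Fock _)
      = gammaIncl V.symm (k + 1)
        (warpedSectorCreate θ (V h) k (sectorGamma V.toLinearIsometry k Ψ)) := by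
    simp only [warpedCreate, LinearMap.comp_apply, secondQuant_inclSector V, raiseOp_inclSector,
      coe_secondQuant_inclSector, ContinuousLinearMap.coe_coe]
  rw [h_limit]
  refine isWarped_of_forall_eq_phaseMul (measurable_leadMomentum m θ k).neg
    (measurable_totalMomentum_tail m k)
    (tensorCons (V h) (sectorGamma V.toLinearIsometry k Ψ : WaveFunction _ k))
    ((gammaIncl V.symm (k + 1)).comp (createProj _ k)) fun x y => ?_
  rw [adjointX_create_groupX, secondQuant_inclSector, secondQuant_inclSector, create,
    raiseOp_inclSector, coe_secondQuant_inclSector, ContinuousLinearMap.coe_coe,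
    sectorCreate_translate1_sectorGamma_translate1 hθ]
  rfl

lemma isWarped_annihilate_inclSector_zero (h : H1 n m) (Ψ : Sector (shellMeasure n m) 0) :
    IsWarped θ V (annihilate h) (inclSector _ 0 Ψ)
      (warpedAnnihilate θ V h (inclSector _ 0 Ψ) : Fock _) := by
  have h_limit : warpedAnnihilate θ V h (inclSector _ 0 Ψ) = 0 := by
    simp only [warpedAnnihilate, LinearMap.comp_apply, secondQuant_inclSector,
      lowerOp_inclSector_zero, map_zero]
  rw [h_limit]
  refine isWarped_zero_of_forall_eq_zero fun x y => ?_
  rw [adjointX_annihilate_groupX, secondQuant_inclSector, secondQuant_inclSector, annihilate,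
    lowerOp_inclSector_zero, map_zero]

lemma isWarped_annihilate_inclSector_succ (hθ : IsLorentzSkew θ) (h : H1 n m)
    (Ψ : Sector (shellMeasure n m) (k + 1)) :
    IsWarped θ V (annihilate h) (inclSector _ (k + 1) Ψ)
      (warpedAnnihilate θ V h (inclSector _ (k + 1) Ψ) : Fock _) := by
  have h_limit : (warpedAnnihilate θ V h (inclSector _ (k + 1) Ψ) : Fock _)
      = gammaIncl V.symm k ((warpedSectorCreate θ (V h) k).adjoint
        (sectorGamma V.toLinearIsometry (k + 1) Ψ)) := by
    simp only [warpedAnnihilate, LinearMap.comp_apply, secondQuant_inclSector V,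
      lowerOp_inclSector_succ, coe_secondQuant_inclSector, ContinuousLinearMap.coe_coe]
  rw [h_limit, adjoint_warpedSectorCreate_apply hθ, ← ContinuousLinearMap.comp_apply]
  have h_phase (x y : SpaceTime n) :
      (adjointX V (Matrix.toEuclideanLin θ x) (annihilate h)
          (groupX V y (inclSector _ (k + 1) Ψ)) : Fock _)
        = (gammaIncl V.symm k).comp (annihilateProj (V h) k)
          (phaseMul (measurable_oscPhase (spaceReflect n) (measurable_leadMomentum m θ k)
            (measurable_totalMomentum m (k + 1)) (x, y))
            (sectorGamma V.toLinearIsometry (k + 1) Ψ)) := by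
    rw [adjointX_annihilate_groupX, secondQuant_inclSector, secondQuant_inclSector, annihilate,
      lowerOp_inclSector_succ, coe_secondQuant_inclSector, ContinuousLinearMap.coe_coe,
      adjoint_sectorCreate_translate1_sectorGamma_translate1 hθ, ContinuousLinearMap.comp_apply]
  exact isWarped_of_forall_eq_phaseMul (measurable_leadMomentum m θ k)
    (measurable_totalMomentum m (k + 1)) _ _ h_phase

lemma isWarped_annihilate (hθ : IsLorentzSkew θ) (h : H1 n m)
    (Φ : finiteParticle (shellMeasure n m)) :
    IsWarped θ V (annihilate h) Φ (warpedAnnihilate θ V h Φ : Fock _) :=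
  isWarped_of_forall_inclSector (fun k Ψ => match k with
    | 0 => isWarped_annihilate_inclSector_zero h Ψ
    | _ + 1 => isWarped_annihilate_inclSector_succ hθ h Ψ) Φ

end Warp

section Star

variable {α : Type*} [MeasurableSpace α] {μ : Measure α} {p : ℝ≥0∞}

lemma norm_star_Lp {G : Type*} [NormedAddCommGroup G] [StarAddMonoid G] [NormedStarGroup G]
    (f : Lp G p μ) : ‖star f‖ = ‖f‖ := by
  rw [Lp.norm_def, Lp.norm_def]
  refine congrArg _ (eLpNorm_congr_norm_ae ?_)
  filter_upwards [Lp.coeFn_star f] with x hx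
  rw [hx, Pi.star_apply, norm_star]

end Star

end DeformedField

end

open DeformedField in
theorem mainTheorem8_general {n : ℕ} {m : ℝ} {θ : Matrix (Fin (n + 1)) (Fin (n + 1)) ℝ}
    (hθ : IsLorentzSkew θ) (V : H1 n m ≃ₗᵢ[ℂ] H1 n m) (g h : H1 n m) :
    ∃ a aStar φ : finiteParticle (shellMeasure n m) →ₗ[ℂ] Fock (shellMeasure n m),
      ∀ Φ : finiteParticle (shellMeasure n m),
        IsWarped θ V (annihilate g) Φ (a Φ) ∧
        IsWarped θ V (create h) Φ (aStar Φ) ∧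
        IsWarped θ V (annihilate g + create h) Φ (φ Φ) ∧
        φ Φ = a Φ + aStar Φ ∧
        ‖a Φ‖ ≤ ‖g‖ * ‖sqrtNumberAddOne (shellMeasure n m) Φ‖ ∧
        ‖aStar Φ‖ ≤ ‖h‖ * ‖sqrtNumberAddOne (shellMeasure n m) Φ‖ ∧
        ‖φ Φ‖ ≤ (‖h‖ + ‖g‖) * ‖sqrtNumberAddOne (shellMeasure n m) (secondQuant V Φ)‖ ∧
        ‖sqrtNumberAddOne (shellMeasure n m) (secondQuant V Φ)‖ =
          ‖sqrtNumberAddOne (shellMeasure n m) Φ‖ := by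
  let a := (finiteParticle _).subtype ∘ₗ warpedAnnihilate θ V g
  let aStar := (finiteParticle _).subtype ∘ₗ warpedCreate θ V h
  refine ⟨a, aStar, a + aStar, fun Φ => ?_⟩
  have h_ann : IsWarped θ V (annihilate g) Φ (a Φ) := isWarped_annihilate hθ g Φ
  have h_create : IsWarped θ V (create h) Φ (aStar Φ) := isWarped_create hθ h Φ
  have h_ann_le : ‖a Φ‖ ≤ ‖g‖ * ‖sqrtNumberAddOne _ Φ‖ := norm_warpedAnnihilate_le g Φ
  have h_create_le : ‖aStar Φ‖ ≤ ‖h‖ * ‖sqrtNumberAddOne _ Φ‖ := norm_warpedCreate_le h Φ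
  have h_number := norm_sqrtNumberAddOne_secondQuant V Φ
  refine ⟨h_ann, h_create, h_ann.add_operator h_create, rfl, h_ann_le, h_create_le, ?_, h_number⟩
  rw [h_number, add_comm ‖h‖, add_mul]
  exact (norm_add_le _ _).trans (add_le_add h_ann_le h_create_le)

theorem mainTheorem8 (n : ℕ) (hn : 1 ≤ n) (m : ℝ) (hm : 0 < m)
    (θ : Matrix (Fin (n + 1)) (Fin (n + 1)) ℝ) (hθ : DeformedField.IsLorentzSkew θ)
    (V : DeformedField.H1 n m ≃ₗᵢ[ℂ] DeformedField.H1 n m)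
    (f : SchwartzMap (DeformedField.SpaceTime n) ℂ) :
    ∃ a aStar φ : DeformedField.DeltaX V →ₗ[ℂ] DeformedField.Fock (DeformedField.shellMeasure n m),
      ∀ Φ : DeformedField.DeltaX V,
        DeformedField.IsWarped θ V
          (DeformedField.annihilate (star (DeformedField.testMinus hm f))) Φ (a Φ) ∧
        DeformedField.IsWarped θ V
          (DeformedField.create (DeformedField.testPlus hm f)) Φ (aStar Φ) ∧
        DeformedField.IsWarped θ V (DeformedField.freeField hm f) Φ (φ Φ) ∧
        φ Φ = a Φ + aStar Φ ∧
        ‖a Φ‖ ≤ ‖DeformedField.testMinus hm f‖ *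
          ‖DeformedField.sqrtNumberAddOne (DeformedField.shellMeasure n m)
            (Φ : DeformedField.finiteParticle (DeformedField.shellMeasure n m))‖ ∧
        ‖aStar Φ‖ ≤ ‖DeformedField.testPlus hm f‖ *
          ‖DeformedField.sqrtNumberAddOne (DeformedField.shellMeasure n m)
            (Φ : DeformedField.finiteParticle (DeformedField.shellMeasure n m))‖ ∧
        ‖φ Φ‖ ≤ (‖DeformedField.testPlus hm f‖ + ‖DeformedField.testMinus hm f‖) *
          ‖DeformedField.sqrtNumberAddOne (DeformedField.shellMeasure n m)
            (DeformedField.secondQuant V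
              (Φ : DeformedField.finiteParticle (DeformedField.shellMeasure n m)))‖ ∧
        ‖DeformedField.sqrtNumberAddOne (DeformedField.shellMeasure n m)
            (DeformedField.secondQuant V
              (Φ : DeformedField.finiteParticle (DeformedField.shellMeasure n m)))‖ =
          ‖DeformedField.sqrtNumberAddOne (DeformedField.shellMeasure n m)
            (Φ : DeformedField.finiteParticle (DeformedField.shellMeasure n m))‖ := by
  obtain ⟨a, aStar, φ, h⟩ := mainTheorem8_general hθ V (star (DeformedField.testMinus hm f))
    (DeformedField.testPlus hm f)
  rw [DeformedField.norm_star_Lp] at h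
  exact ⟨a ∘ₗ (DeformedField.DeltaX V).subtype, aStar ∘ₗ (DeformedField.DeltaX V).subtype,
    φ ∘ₗ (DeformedField.DeltaX V).subtype, fun Φ => h Φ⟩
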